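/- Let $d\ge 1$, let $(M_1,g_1)$ and $(M_2,g_2)$ be smooth (Hausdorff, second countable) oriented $d$-dimensional Riemannian manifolds, possibly with boundary, and let $f:M_1\to M_2$ be smooth. For oriented $d$-dimensional inner product spaces $V,W$ with Hodge duals $\star^k:\Lambda_k\to\Lambda_{d-k}$ and a linear map $A:V\to W$, put $\operatorname{Det}A=\star_W^d\circ\Lambda^dA\circ\star_V^0\in\mathbb R$ and $\operatorname{Cof}A=(-1)^{d-1}\star_W^{d-1}\circ\Lambda^{d-1}A\circ\star_V^1\in\operatorname{Hom}(V,W)$. Applied to $df_p:T_pM_1\to T_{f(p)}M_2$, this gives the function $\operatorname{Det}df$ and the $f^*TM_2$-valued one-form $\operatorname{Cof}df$ on $M_1$. For a smooth vector field $X$ on $M_2$ let $f^*X=X\circ f$, a section of $f^*TM_2$, and let $\operatorname{Piola}(X)=(\operatorname{Cof}df)^T(f^*X)$, a vector field on $M_1$. Let $\operatorname{div}X=\operatorname{tr}\nabla X$ with $\nabla$ the Levi-Civita connection, and let $\nabla^{f^*TM_2}$ be the connection on $f^*TM_2$ induced by the Levi-Civita connection of $M_2$. The coderivative $\delta_{\nabla^{f^*TM_2}}\omega$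 of an $f^*TM_2$-valued one-form $\omega$ is the smooth section of $f^*TM_2$ with $$\int_{M_1}\langle\sigma,\delta_{\nabla^{f^*TM_2}}\omega\rangle\,d\mathrm{Vol}_1=\int_{M_1}\langle\nabla^{f^*TM_2}\sigma,\omega\rangle\,d\mathrm{Vol}_1$$ for all smooth sections $\sigma$ of $f^*TM_2$ with compact support in the interior of $M_1$. Then the coderivative $\delta_{\nabla^{f^*TM_2}}\operatorname{Cof}df$ exists and is unique, and for every smooth vector field $X$ on $M_2$ the vector field $\operatorname{Piola}(X)$ is smooth and, at every point of $M_1$, $$\operatorname{div}\operatorname{Piola}(X)=\big((\operatorname{div}X)\circ f\big)\,\operatorname{Det}df-\big\langle f^*X,\ \delta_{\nabla^{f^*TM_2}}\operatorname{Cof}df\big\rangle .$$ -/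

import Mathlib

open Bundle Set Filter Topology MeasureTheory
open scoped Manifold ContDiff

noncomputable section

namespace Piola

/-! ### Linear algebra: Hodge dual, determinant and cofactor -/

section LinearAlgebra

variable {d : ℕ}
  {V : Type*} [NormedAddCommGroup V] [InnerProductSpace ℝ V] [FiniteDimensional ℝ V]
  [Fact (Module.finrank ℝ V = d)]
  {W : Type*} [NormedAddCommGroup W] [InnerProductSpace ℝ W] [FiniteDimensional ℝ W]
  [Fact (Module.finrank ℝ W = d)]

/-- The unit volume form of an oriented inner product space, as a linear functional on the whole
exterior algebra: it sends `v₁ ∧ ⋯ ∧ v_d` to `Vol (v₁, …, v_d)` and vanishes in degrees `≠ d`. -/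
def volFunctional (o : Orientation ℝ V (Fin d)) : ExteriorAlgebra ℝ V →ₗ[ℝ] ℝ :=
  ExteriorAlgebra.liftAlternating (R := ℝ) (M := V) (N := ℝ) (Pi.single d o.volumeForm)

/-- The Hodge dual `⋆ᵏ : Λ_k V → Λ_l V`, where `k + l = d`. With `e` an orthonormal basis of `V` and
`e_S = e_{s₁} ∧ ⋯ ∧ e_{s_l}` (`s₁ < ⋯ < s_l`) the induced orthonormal basis of `Λ_l V`, it is
`⋆β = ∑_S Vol (β ∧ e_S) e_S`; equivalently `α ∧ ⋆β = ⟨α, β⟩ Vol`. -/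
def hodgeStar (o : Orientation ℝ V (Fin d)) (k l : ℕ) : ⋀[ℝ]^k V →ₗ[ℝ] ⋀[ℝ]^l V :=
  ∑ S : Set.powersetCard (Fin (Module.finrank ℝ V)) l,
    LinearMap.smulRight
      (volFunctional o ∘ₗ
        LinearMap.mulRight ℝ
          (exteriorPower.ιMulti_family ℝ l (stdOrthonormalBasis ℝ V) S : ExteriorAlgebra ℝ V) ∘ₗ
        (⋀[ℝ]^k V).subtype)
      (exteriorPower.ιMulti_family ℝ l (stdOrthonormalBasis ℝ V) S)

/-- The intrinsic determinant `Det A = ⋆_W^d ∘ Λ^d A ∘ ⋆_V^0`, with `Λ_0 ≃ ℝ`. -/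
def Det (oV : Orientation ℝ V (Fin d)) (oW : Orientation ℝ W (Fin d)) (A : V →ₗ[ℝ] W) : ℝ :=
  exteriorPower.zeroEquiv ℝ W
    (hodgeStar oW d 0 (exteriorPower.map d A
      (hodgeStar oV 0 d ((exteriorPower.zeroEquiv ℝ V).symm 1))))

/-- The intrinsic cofactor `Cof A = (-1)^(d-1) ⋆_W^{d-1} ∘ Λ^{d-1} A ∘ ⋆_V^1`, with `Λ_1 V ≃ V` and
`Λ_1 W ≃ W`. -/
def Cof (oV : Orientation ℝ V (Fin d)) (oW : Orientation ℝ W (Fin d)) (A : V →ₗ[ℝ] W) :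
    V →ₗ[ℝ] W :=
  ((-1 : ℝ) ^ (d - 1)) •
    ((exteriorPower.oneEquiv ℝ W).toLinearMap ∘ₗ hodgeStar oW (d - 1) 1 ∘ₗ
      exteriorPower.map (d - 1) A ∘ₗ hodgeStar oV 1 (d - 1) ∘ₗ
      (exteriorPower.oneEquiv ℝ V).symm.toLinearMap)

end LinearAlgebra

/-! ### Oriented Riemannian manifolds, possibly with boundary -/

section Manifold

variable {d : ℕ}
  {H : Type*} [TopologicalSpace H] (I : ModelWithCorners ℝ (EuclideanSpace ℝ (Fin d)) H)
  {M : Type*} [TopologicalSpace M] [ChartedSpace H M]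

instance instFiniteDimensionalTangent (p : M) : FiniteDimensional ℝ (TangentSpace I p) :=
  inferInstanceAs (FiniteDimensional ℝ (EuclideanSpace ℝ (Fin d)))

instance instFactFinrankTangent (p : M) : Fact (Module.finrank ℝ (TangentSpace I p) = d) :=
  ⟨finrank_euclideanSpace_fin (𝕜 := ℝ) (n := d)⟩

variable (M) in
/-- An orientation of a manifold: an orientation of every tangent space which, near every point, is
constant when read in the local trivialization of the tangent bundle around that point. -/
structure ManifoldOrientation [IsManifold I 1 M] where
  /-- The orientation of the tangent space at a point. -/
  or : ∀ p : M, Orientation ℝ (TangentSpace I p) (Fin d)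
  locally_constant : ∀ p : M, ∃ c : Orientation ℝ (EuclideanSpace ℝ (Fin d)) (Fin d),
    ∀ᶠ q in 𝓝 p,
      ∀ hq : q ∈ (trivializationAt (EuclideanSpace ℝ (Fin d)) (TangentSpace I (M := M)) p).baseSet,
        Orientation.map (Fin d)
          ((trivializationAt (EuclideanSpace ℝ (Fin d)) (TangentSpace I (M := M))
            p).continuousLinearEquivAt ℝ q hq).toLinearEquiv (or q) = c

variable [IsManifold I 1 M] [RiemannianBundle (fun x : M ↦ TangentSpace I x)]

/-- The coordinate vector field `∂_i` of the chart around `p`, at the point `q` of its domain. -/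
def coordVector (p q : M) (i : Fin d) : TangentSpace I q :=
  (trivializationAt (EuclideanSpace ℝ (Fin d)) (TangentSpace I (M := M)) p).symm q
    (EuclideanSpace.single i (1 : ℝ))

/-- The Riemannian volume on the domain of the chart around `p`, as a measure on `M`: the image
under the inverse chart of `√(det (g_ij)) dx`. -/
def chartVolume [MeasurableSpace M] (p : M) : Measure M :=
  Measure.map (extChartAt I p).symm
    (((volume : Measure (EuclideanSpace ℝ (Fin d))).withDensity fun y ↦
      ENNReal.ofReal (√ (Matrix.det (Matrix.of fun i j : Fin d ↦
        inner ℝ (coordVector I p ((extChartAt I p).symm y) i)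
          (coordVector I p ((extChartAt I p).symm y) j))))).restrict
      (extChartAt I p).target)

variable (M) in
/-- The Riemannian volume measure. The measures `√(det g) dx` of the charts agree on overlaps,
so their supremum is the measure that restricts to each of them. -/
def riemannianVolume [MeasurableSpace M] : Measure M :=
  ⨆ p : M, chartVolume I p

/-- The right-hand side of the Koszul formula for `2 ⟨∇_U X, W⟩`:
`U⟨X,W⟩ + X⟨U,W⟩ - W⟨U,X⟩ + ⟨[U,X],W⟩ - ⟨[U,W],X⟩ - ⟨[X,W],U⟩`. -/
def koszul (U X W : ∀ q : M, TangentSpace I q) (p : M) : ℝ :=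
  mvfderiv I (fun q ↦ inner ℝ (X q) (W q)) p (U p)
    + mvfderiv I (fun q ↦ inner ℝ (U q) (W q)) p (X p)
    - mvfderiv I (fun q ↦ inner ℝ (U q) (X q)) p (W p)
    + inner ℝ (VectorField.mlieBracket I U X p) (W p)
    - inner ℝ (VectorField.mlieBracket I U W p) (X p)
    - inner ℝ (VectorField.mlieBracket I X W p) (U p)

/-- The Levi-Civita connection, `leviCivita I X p u = (∇_u X)(p)`: the tangent vector at `p` with
`2 ⟨∇_u X, w⟩` given by the Koszul formula for all `w`, where `u` and `w` are extended to smooth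
local vector fields. -/
def leviCivita (X : ∀ q : M, TangentSpace I q) (p : M) (u : TangentSpace I p) : TangentSpace I p :=
  ∑ i, ((1 / 2 : ℝ) * koszul I (FiberBundle.extend (EuclideanSpace ℝ (Fin d)) u) X
      (FiberBundle.extend (EuclideanSpace ℝ (Fin d)) (stdOrthonormalBasis ℝ (TangentSpace I p) i))
      p) • stdOrthonormalBasis ℝ (TangentSpace I p) i

/-- The divergence `div X = tr (∇ X) = ∑ i, ⟨∇_{e_i} X, e_i⟩`. -/
def divergence (X : ∀ q : M, TangentSpace I q) (p : M) : ℝ :=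
  ∑ i, inner ℝ (leviCivita I X p (stdOrthonormalBasis ℝ (TangentSpace I p) i))
    (stdOrthonormalBasis ℝ (TangentSpace I p) i)

end Manifold

/-! ### Maps between Riemannian manifolds -/

section Maps

variable {d : ℕ}
  {H₁ : Type*} [TopologicalSpace H₁] (I₁ : ModelWithCorners ℝ (EuclideanSpace ℝ (Fin d)) H₁)
  {M₁ : Type*} [TopologicalSpace M₁] [ChartedSpace H₁ M₁] [IsManifold I₁ 1 M₁]
  [RiemannianBundle (fun x : M₁ ↦ TangentSpace I₁ x)]
  {H₂ : Type*} [TopologicalSpace H₂] (I₂ : ModelWithCorners ℝ (EuclideanSpace ℝ (Fin d)) H₂)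
  {M₂ : Type*} [TopologicalSpace M₂] [ChartedSpace H₂ M₂] [IsManifold I₂ 1 M₂]
  [RiemannianBundle (fun x : M₂ ↦ TangentSpace I₂ x)]

/-- `σ` is a smooth section of `f^* TM₂`, i.e. `p ↦ (f p, σ p)` is a smooth map `M₁ → TM₂`. -/
def IsSmoothAlong (f : M₁ → M₂) (σ : ∀ p : M₁, TangentSpace I₂ (f p)) : Prop :=
  ContMDiff I₁ I₂.tangent ∞ (fun p ↦ (⟨f p, σ p⟩ : TangentBundle I₂ M₂))

/-- The connection on `f^* TM₂` induced by the Levi-Civita connection of `M₂`,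
`pullbackConnection I₁ I₂ f σ p u = (∇_u σ)(p)`. Write `σ = ∑ a, σ^a (E_a ∘ f)` near `p`, with `E_a`
the coordinate frame of the chart around `f p`; then `∇_u σ = ∑ a, dσ^a(u) E_a + σ^a ∇_{df u} E_a`.
The first sum is the derivative of the coordinate vector of `σ`, and the second one is `∇_{df u}` of
the field which is constant in the frame `E_a` and takes the value `σ p` at `f p`. -/
def pullbackConnection (f : M₁ → M₂) (σ : ∀ p : M₁, TangentSpace I₂ (f p)) (p : M₁)
    (u : TangentSpace I₁ p) : TangentSpace I₂ (f p) :=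
  (trivializationAt (EuclideanSpace ℝ (Fin d)) (TangentSpace I₂ (M := M₂)) (f p)).symm (f p)
      (mvfderiv I₁ (fun q ↦
        ((trivializationAt (EuclideanSpace ℝ (Fin d)) (TangentSpace I₂ (M := M₂)) (f p))
          ⟨f q, σ q⟩).2) p u)
    + leviCivita I₂ (FiberBundle.extend (EuclideanSpace ℝ (Fin d)) (σ p)) (f p)
        (mfderiv I₁ I₂ f p u)

/-- `η` is the coderivative of the `f^* TM₂`-valued one-form `α`: it is a smooth section of `f^* TM₂`
and `∫ ⟨σ, η⟩ dVol = ∫ ⟨∇σ, α⟩ dVol` for every smooth section `σ` of `f^* TM₂` with compact support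
in the interior of `M₁`. The inner product of one-forms is
`⟨∇σ, α⟩ = ∑ i, ⟨∇_{e_i} σ, α e_i⟩` for an orthonormal basis `e_i`. -/
structure IsCoderivative [MeasurableSpace M₁] (f : M₁ → M₂)
    (α : ∀ p : M₁, TangentSpace I₁ p →ₗ[ℝ] TangentSpace I₂ (f p))
    (η : ∀ p : M₁, TangentSpace I₂ (f p)) : Prop where
  smooth : IsSmoothAlong I₁ I₂ f η
  adjoint : ∀ σ : ∀ p : M₁, TangentSpace I₂ (f p), IsSmoothAlong I₁ I₂ f σ →
    IsCompact (closure {p | σ p ≠ 0}) → closure {p | σ p ≠ 0} ⊆ I₁.interior M₁ →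
    ∫ p, inner ℝ (σ p) (η p) ∂(riemannianVolume I₁ M₁) =
      ∫ p, ∑ i, inner ℝ
          (pullbackConnection I₁ I₂ f σ p (stdOrthonormalBasis ℝ (TangentSpace I₁ p) i))
          (α p (stdOrthonormalBasis ℝ (TangentSpace I₁ p) i)) ∂(riemannianVolume I₁ M₁)

variable {I₁ I₂} (o₁ : ManifoldOrientation I₁ M₁) (o₂ : ManifoldOrientation I₂ M₂)

/-- The function `Det df` on `M₁`. -/
def detDifferential (f : M₁ → M₂) (p : M₁) : ℝ :=
  Det (o₁.or p) (o₂.or (f p)) (mfderiv I₁ I₂ f p).toLinearMap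

/-- The `f^* TM₂`-valued one-form `Cof df` on `M₁`. -/
def cofDifferential (f : M₁ → M₂) (p : M₁) : TangentSpace I₁ p →ₗ[ℝ] TangentSpace I₂ (f p) :=
  Cof (o₁.or p) (o₂.or (f p)) (mfderiv I₁ I₂ f p).toLinearMap

/-- The Piola transform `Piola(X) = (Cof df)^T (f^* X)`, a vector field on `M₁`. -/
def piola (f : M₁ → M₂) (X : ∀ y : M₂, TangentSpace I₂ y) (p : M₁) : TangentSpace I₁ p :=
  LinearMap.adjoint (cofDifferential o₁ o₂ f p) (X (f p))

end Maps

end Piola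

end

/-!
For a section `σ` of `f^* TM₂` let `Z = (Cof df)ᵀ σ`. The identity behind everything is `div Z =
⟨∇σ, Cof df⟩`: the cofactor has no divergence of its own.

In charts the components of `vol₁ • Z` are `(vol₂ ∘ f) * det (∂₁ f, …, σ, …, ∂_d f)` with `σ` in
position `i`, where `vol` is the Riemannian volume of the coordinate frame. Differentiate the
`i`-th component in direction `i` and sum. The second derivatives of `f` are symmetric and cancel
in the alternating determinant. The Christoffel symbols are symmetric with trace `d log vol₂`, so
the derivative of `vol₂` supplies exactly the terms that turn the derivatives of `σ` into
covariant ones. For `f = id` the same computation expresses `div` as the coordinate divergence of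
`vol • Z`.

By the divergence theorem `∫ ⟨∇σ, Cof df⟩ = ∫ div Z = 0` for test sections `σ`, so `0` is a
coderivative of `Cof df`. It is the only one, because a continuous section orthogonal to all test
sections vanishes on the interior of `M₁`, which is dense. For `σ = X ∘ f` we have `∇σ = ∇X ∘ df`,
and `(Cof df)ᵀ df = Det df • id` turns `⟨∇σ, Cof df⟩` into `(div X ∘ f) * Det df`.
-/

noncomputable section

namespace Piola

/-! ### Top-degree forms and cofactors -/

section TopForms

variable {d : ℕ} {R : Type*} [CommRing R] {V : Type*} [AddCommGroup V] [Module R V]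
  {W : Type*} [AddCommGroup W] [Module R W]

/-- The alternating form `v ↦ ∑ i, ℓ (v i) * α (A v₁, …, w, …, A v_d)` with `w` in position `i`. It
is the exterior product of `ℓ` with the pullback along `A` of the contraction of `α` with `w`. -/
def substitutionForm (α : W [⋀^Fin d]→ₗ[R] R) (A : V →ₗ[R] W) (ℓ : V →ₗ[R] R) (w : W) :
    V [⋀^Fin d]→ₗ[R] R :=
  match d, α with
  | 0, _ => 0
  | _ + 1, α => AlternatingMap.alternatizeUncurryFin
      (ℓ.smulRight ((α.curryLeft w).compLinearMap A))

lemma substitutionForm_apply (α : W [⋀^Fin d]→ₗ[R] R) (A : V →ₗ[R] W) (ℓ : V →ₗ[R] R) (w : W)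
    (v : Fin d → V) :
    substitutionForm α A ℓ w v = ∑ i, ℓ (v i) * α (Function.update (A ∘ v) i w) := by
  cases d with
  | zero => simp [substitutionForm]
  | succ k =>
    simp only [substitutionForm, AlternatingMap.alternatizeUncurryFin_apply]
    refine Finset.sum_congr rfl fun i _ ↦ ?_
    have insert_eq : Function.update (A ∘ v) i w = i.insertNth w (A ∘ i.removeNth v) := by
      rw [← Fin.insertNth_removeNth]
      rfl
    rw [insert_eq, AlternatingMap.map_insertNth]
    simp only [LinearMap.smulRight_apply, AlternatingMap.smul_apply, smul_eq_mul,
      AlternatingMap.compLinearMap_apply, AlternatingMap.curryLeft_apply_apply, zsmul_eq_mul,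
      Int.cast_pow, Int.cast_neg, Int.cast_one, Function.comp_def]
    ring

lemma alternatingMap_apply_eq_det_mul {ι : Type*} [Fintype ι] [DecidableEq ι]
    (α : W [⋀^ι]→ₗ[R] R) (e : Module.Basis ι R W) (v : ι → W) : α v = e.det v * α e := by
  conv_lhs => rw [α.eq_smul_basis_det e]
  simp [mul_comm]

lemma alternatingMap_update_basis {ι : Type*} [Finite ι] [DecidableEq ι] {N : Type*}
    [AddCommGroup N] [Module R N] (α : W [⋀^ι]→ₗ[R] N) (e : Module.Basis ι R W) (i : ι) (w : W) :
    α (Function.update e i w) = e.repr w i • α e := by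
  cases nonempty_fintype ι
  conv_lhs => rw [← e.sum_repr w]
  simp only [AlternatingMap.map_update_sum, AlternatingMap.map_update_smul]
  rw [Finset.sum_eq_single i (fun j _ hj ↦ by rw [AlternatingMap.map_update_self _ _ hj.symm,
    smul_zero]) (by simp), Function.update_eq_self]

lemma sum_mul_alternatingMap_update (α : W [⋀^Fin d]→ₗ[R] R) (e : Module.Basis (Fin d) R W)
    (ℓ : W →ₗ[R] R) (w : W) (v : Fin d → W) :
    ∑ i, ℓ (v i) * α (Function.update v i w) = α v * ℓ w := by
  have on_basis : ∑ i, ℓ (e i) * α (Function.update e i w) = α e * ℓ w := by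
    conv_rhs => rw [← e.sum_repr w]
    simp only [alternatingMap_update_basis, map_sum, map_smul, smul_eq_mul, Finset.mul_sum]
    exact Finset.sum_congr rfl fun i _ ↦ by ring
  calc ∑ i, ℓ (v i) * α (Function.update v i w)
      = substitutionForm α LinearMap.id ℓ w v := (substitutionForm_apply α LinearMap.id ℓ w v).symm
    _ = e.det v * substitutionForm α LinearMap.id ℓ w e := alternatingMap_apply_eq_det_mul _ e v
    _ = e.det v * (α e * ℓ w) := by rw [substitutionForm_apply, ← on_basis]; rfl
    _ = α v * ℓ w := by rw [alternatingMap_apply_eq_det_mul α e v, mul_assoc]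

lemma sum_alternatingMap_update_smul (α : W [⋀^Fin d]→ₗ[R] R) (e : Module.Basis (Fin d) R W)
    (w : W) (v : Fin d → W) : ∑ i, α (Function.update v i w) • v i = α v • w := by
  refine e.ext_elem fun j ↦ ?_
  simpa [mul_comm] using sum_mul_alternatingMap_update α e (e.coord j) w v

lemma sum_alternatingMap_update_map (α : W [⋀^Fin d]→ₗ[R] R) (e : Module.Basis (Fin d) R W)
    (L : W →ₗ[R] W) (v : Fin d → W) :
    ∑ i, α (Function.update v i (L (v i))) = α v * LinearMap.trace R W L := by
  have expand (i : Fin d) : α (Function.update v i (L (v i))) =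
      ∑ k, (e.coord k ∘ₗ L) (v i) * α (Function.update v i (e k)) := by
    conv_lhs => rw [← e.sum_repr (L (v i))]
    simp only [AlternatingMap.map_update_sum, AlternatingMap.map_update_smul, smul_eq_mul,
      LinearMap.comp_apply, Module.Basis.coord_apply]
  simp only [expand]
  rw [Finset.sum_comm, LinearMap.trace_eq_matrix_trace R e, Matrix.trace, Finset.mul_sum]
  refine Finset.sum_congr rfl fun k _ ↦ ?_
  rw [sum_mul_alternatingMap_update α e, Matrix.diag_apply, LinearMap.toMatrix_apply]
  rfl

lemma sum_alternatingMap_update_update_eq_zero {ι : Type*} [Fintype ι] [DecidableEq ι]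
    {N : Type*} [AddCommGroup N] [Module R N] (α : W [⋀^ι]→ₗ[R] N) (v : ι → W) (w : W)
    {S : ι → ι → W} (S_symm : ∀ i k, S i k = S k i) :
    ∑ i, ∑ k ∈ Finset.univ.erase i,
      α (Function.update (Function.update v i w) k (S i k)) = 0 := by
  rw [Finset.sum_sigma']
  refine Finset.sum_involution (fun x _ ↦ ⟨x.2, x.1⟩) ?_ ?_ ?_ ?_
  · rintro ⟨i, k⟩ hik
    have hki : k ≠ i := by simpa using hik
    have swap_eq : Function.update (Function.update v i w) k (S i k) ∘ Equiv.swap i k =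
        Function.update (Function.update v k w) i (S k i) := by
      ext1 j
      rcases eq_or_ne j i with rfl | hji
      · simp [S_symm]
      · rcases eq_or_ne j k with rfl | hjk
        · simp [hji, hki.symm]
        · simp [Equiv.swap_apply_of_ne_of_ne hji hjk, hji, hjk]
    rw [← swap_eq, AlternatingMap.map_swap _ _ hki.symm, add_neg_cancel]
  · rintro ⟨i, k⟩ hik _ h
    simp_all
  · rintro ⟨i, k⟩ hik
    simpa [eq_comm] using hik
  · simp

end TopForms

section HodgeDuals

variable {d : ℕ}
  {V : Type*} [NormedAddCommGroup V] [InnerProductSpace ℝ V] [FiniteDimensional ℝ V]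
  [hV : Fact (Module.finrank ℝ V = d)]
  {W : Type*} [NormedAddCommGroup W] [InnerProductSpace ℝ W] [FiniteDimensional ℝ W]
  [hW : Fact (Module.finrank ℝ W = d)]

variable (d V) in
/-- The standard orthonormal basis of a `d`-dimensional inner product space, indexed by `Fin d`. -/
def stdFrame : OrthonormalBasis (Fin d) ℝ V :=
  (stdOrthonormalBasis ℝ V).reindex (finCongr hV.out)

lemma hodgeStar_apply (o : Orientation ℝ V (Fin d)) (k l : ℕ) (β : ⋀[ℝ]^k V) :
    hodgeStar o k l β = ∑ S : Set.powersetCard (Fin d) l,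
      volFunctional o (β * ExteriorAlgebra.ιMulti_family ℝ l (stdFrame d V) S) •
        exteriorPower.ιMulti_family ℝ l (stdFrame d V) S := by
  have reindex (n : ℕ) (h : n = d) (e : Fin n → V) :
      ∑ S : Set.powersetCard (Fin n) l,
        volFunctional o (β * ExteriorAlgebra.ιMulti_family ℝ l e S) •
          exteriorPower.ιMulti_family ℝ l e S =
      ∑ S : Set.powersetCard (Fin d) l,
        volFunctional o (β * ExteriorAlgebra.ιMulti_family ℝ l (e ∘ (finCongr h).symm) S) •
          exteriorPower.ιMulti_family ℝ l (e ∘ (finCongr h).symm) S := by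
    subst h
    rfl
  have coe_stdFrame : (stdFrame d V : Fin d → V) =
      stdOrthonormalBasis ℝ V ∘ (finCongr hV.out).symm := by
    ext1 i
    simp [stdFrame]
  rw [coe_stdFrame, ← reindex _ hV.out, hodgeStar, LinearMap.sum_apply]
  rfl

omit [FiniteDimensional ℝ V] in
lemma volFunctional_ιMulti (o : Orientation ℝ V (Fin d)) (v : Fin d → V) :
    volFunctional o (ExteriorAlgebra.ιMulti ℝ d v) = o.volumeForm v := by
  rw [volFunctional, ExteriorAlgebra.liftAlternating_apply_ιMulti]
  simp

lemma volumeForm_stdFrame_mul_self (o : Orientation ℝ V (Fin d)) :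
    o.volumeForm (stdFrame d V) * o.volumeForm (stdFrame d V) = 1 := by
  rw [← abs_mul_abs_self, o.abs_volumeForm_apply_of_orthonormal (stdFrame d V), one_mul]

lemma volumeForm_basis_ne_zero (o : Orientation ℝ V (Fin d)) (e : Module.Basis (Fin d) ℝ V) :
    o.volumeForm e ≠ 0 := by
  intro h
  have := volumeForm_stdFrame_mul_self o
  rw [alternatingMap_apply_eq_det_mul o.volumeForm e, h, mul_zero, mul_zero] at this
  exact zero_ne_one this

lemma volumeForm_sq (o : Orientation ℝ V (Fin d)) (v : Fin d → V) :
    o.volumeForm v ^ 2 = (Matrix.gram ℝ v).det := by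
  have gram_eq : Matrix.gram ℝ v =
      ((stdFrame d V).toBasis.toMatrix v).transpose * (stdFrame d V).toBasis.toMatrix v := by
    ext i j
    rw [Matrix.mul_apply, Matrix.gram_apply, ← (stdFrame d V).sum_inner_mul_inner]
    refine Finset.sum_congr rfl fun k _ ↦ ?_
    simp [Module.Basis.toMatrix_apply, OrthonormalBasis.repr_apply_apply, real_inner_comm]
  rw [gram_eq, Matrix.det_mul, Matrix.det_transpose, ← Module.Basis.det_apply,
    alternatingMap_apply_eq_det_mul o.volumeForm (stdFrame d V).toBasis, mul_pow,
    OrthonormalBasis.coe_toBasis, sq (o.volumeForm _), volumeForm_stdFrame_mul_self, mul_one, sq]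

lemma hodgeStar_zeroEquiv_symm (o : Orientation ℝ V (Fin d)) :
    hodgeStar o 0 d ((exteriorPower.zeroEquiv ℝ V).symm 1) =
      o.volumeForm (stdFrame d V) • exteriorPower.ιMulti ℝ d (stdFrame d V) := by
  have eq_univ (S : Set.powersetCard (Fin d) d) :
      S = ⟨Finset.univ, by simp [Set.powersetCard.mem_iff]⟩ :=
    Subtype.ext ((Finset.card_eq_iff_eq_univ _).1 (by simp))
  have : Unique (Set.powersetCard (Fin d) d) := ⟨⟨_⟩, eq_univ⟩
  have embedding_eq_id (S : Set.powersetCard (Fin d) d) :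
      (⇑(Set.powersetCard.ofFinEmbEquiv.symm S) : Fin d → Fin d) = id := by
    have : Set.powersetCard.ofFinEmbEquiv.symm S = (OrderIso.refl (Fin d)).toOrderEmbedding := by
      rw [Equiv.symm_apply_eq, eq_univ S]
      exact (eq_univ _).symm
    rw [this]
    rfl
  rw [hodgeStar_apply, Fintype.sum_unique]
  simp only [exteriorPower.ιMulti_family, ExteriorAlgebra.ιMulti_family, embedding_eq_id,
    Function.comp_id]
  congr 1
  rw [exteriorPower.zeroEquiv_symm_apply]
  simp [volFunctional_ιMulti]

lemma zeroEquiv_hodgeStar (o : Orientation ℝ W (Fin d)) (w : Fin d → W) :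
    exteriorPower.zeroEquiv ℝ W (hodgeStar o d 0 (exteriorPower.ιMulti ℝ d w)) =
      o.volumeForm w := by
  have : Unique (Set.powersetCard (Fin d) 0) :=
    ⟨⟨⟨∅, by simp [Set.powersetCard.mem_iff]⟩⟩,
      fun S ↦ Subtype.ext (Finset.card_eq_zero.1 (by simp))⟩
  rw [hodgeStar_apply, Fintype.sum_unique, map_smul, exteriorPower.ιMulti_family,
    exteriorPower.zeroEquiv_ιMulti]
  simp [volFunctional_ιMulti]

lemma volumeForm_mul_Det (oV : Orientation ℝ V (Fin d)) (oW : Orientation ℝ W (Fin d))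
    (A : V →ₗ[ℝ] W) (b : Module.Basis (Fin d) ℝ V) :
    oV.volumeForm b * Det oV oW A = oW.volumeForm (A ∘ b) := by
  have on_frame : Det oV oW A =
      oV.volumeForm (stdFrame d V) * oW.volumeForm (A ∘ stdFrame d V) := by
    rw [Det, hodgeStar_zeroEquiv_symm, map_smul, map_smul, map_smul,
      exteriorPower.map_apply_ιMulti, zeroEquiv_hodgeStar, smul_eq_mul]
  have pullback : oW.volumeForm (A ∘ b) =
      (stdFrame d V).toBasis.det b * oW.volumeForm (A ∘ stdFrame d V) := by
    simpa [Function.comp_def] using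
      alternatingMap_apply_eq_det_mul (oW.volumeForm.compLinearMap A) (stdFrame d V).toBasis b
  rw [on_frame, pullback, alternatingMap_apply_eq_det_mul oV.volumeForm (stdFrame d V).toBasis b,
    OrthonormalBasis.coe_toBasis]
  linear_combination ((stdFrame d V).toBasis.det b * oW.volumeForm (A ∘ stdFrame d V)) *
    volumeForm_stdFrame_mul_self oV

lemma inner_oneEquiv_hodgeStar {k : ℕ} {W : Type*} [NormedAddCommGroup W] [InnerProductSpace ℝ W]
    [FiniteDimensional ℝ W] [Fact (Module.finrank ℝ W = k + 1)]
    (o : Orientation ℝ W (Fin (k + 1))) (u : Fin k → W) (w : W) :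
    inner ℝ (exteriorPower.oneEquiv ℝ W (hodgeStar o k 1 (exteriorPower.ιMulti ℝ k u))) w =
      o.volumeForm (Fin.snoc u w) := by
  have embedding_eq_const (j : Fin (k + 1)) : (⇑(Set.powersetCard.ofFinEmbEquiv.symm
      (Set.powersetCard.ofSingleton j)) : Fin 1 → Fin (k + 1)) = fun _ ↦ j := by
    ext1 i
    have := (Set.powersetCard.mem_range_ofFinEmbEquiv_symm_iff_mem
      (Set.powersetCard.ofSingleton j) (Set.powersetCard.ofFinEmbEquiv.symm
      (Set.powersetCard.ofSingleton j) i)).1 ⟨i, rfl⟩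
    simpa [Set.powersetCard.ofSingleton, ← Set.powersetCard.mem_coe_iff] using this
  have snoc_eq (x : W) : o.volumeForm (Fin.snoc u x) =
      o.volumeForm (Function.update (Fin.snoc u 0 : Fin (k + 1) → W) (Fin.last k) x) := by
    rw [Fin.update_snoc_last]
  rw [hodgeStar_apply, ← Equiv.sum_comp Set.powersetCard.ofSingleton, map_sum, sum_inner, snoc_eq]
  simp only [map_smul, exteriorPower.ιMulti_family, ExteriorAlgebra.ιMulti_family,
    embedding_eq_const, exteriorPower.oneEquiv_ιMulti, exteriorPower.ιMulti_apply_coe,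
    ExteriorAlgebra.ιMulti_mul_ιMulti, volFunctional_ιMulti, real_inner_smul_left]
  conv_rhs => rw [← (stdFrame (k + 1) W).sum_repr' w]
  rw [AlternatingMap.map_update_sum]
  refine Finset.sum_congr rfl fun j _ ↦ ?_
  rw [AlternatingMap.map_update_smul, ← snoc_eq, smul_eq_mul, mul_comm]
  congr 2
  exact Fin.append_right_eq_snoc _ _

lemma hodgeStar_oneEquiv_symm {k : ℕ} {V : Type*} [NormedAddCommGroup V] [InnerProductSpace ℝ V]
    [FiniteDimensional ℝ V] [Fact (Module.finrank ℝ V = k + 1)]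
    (o : Orientation ℝ V (Fin (k + 1))) (v : V) :
    hodgeStar o 1 k ((exteriorPower.oneEquiv ℝ V).symm v) =
      ∑ i : Fin (k + 1), o.volumeForm (Matrix.vecCons v (stdFrame (k + 1) V ∘ i.succAbove)) •
        exteriorPower.ιMulti ℝ k (stdFrame (k + 1) V ∘ i.succAbove) := by
  let complSingleton := Set.powersetCard.ofSingleton.trans
    (Set.powersetCard.compl (show k + 1 = Fintype.card (Fin (k + 1)) by simp))
  have embedding_eq_succAbove (j : Fin (k + 1)) :
      (⇑(Set.powersetCard.ofFinEmbEquiv.symm (complSingleton j)) : Fin k → Fin (k + 1)) =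
        j.succAbove := by
    have : Set.powersetCard.ofFinEmbEquiv.symm (complSingleton j) = Fin.succAboveOrderEmb j := by
      rw [Equiv.symm_apply_eq]
      refine SetLike.ext fun x ↦ ?_
      have hx := Set.powersetCard.mem_range_ofFinEmbEquiv_symm_iff_mem
        (Set.powersetCard.ofFinEmbEquiv (Fin.succAboveOrderEmb j)) x
      rw [Equiv.symm_apply_apply] at hx
      rw [← hx]
      simp [complSingleton, Set.powersetCard.ofSingleton, ← Set.powersetCard.mem_coe_iff]
    rw [this]
    rfl
  rw [hodgeStar_apply, ← Equiv.sum_comp complSingleton]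
  refine Finset.sum_congr rfl fun j _ ↦ ?_
  simp only [exteriorPower.ιMulti_family, ExteriorAlgebra.ιMulti_family, embedding_eq_succAbove]
  congr 1
  rw [← volFunctional_ιMulti, ExteriorAlgebra.ιMulti_succ_apply, exteriorPower.oneEquiv_symm_apply]
  simp [ExteriorAlgebra.ιMulti_succ_apply, Matrix.vecTail, Function.comp_def]

lemma inner_Cof (oV : Orientation ℝ V (Fin d)) (oW : Orientation ℝ W (Fin d)) (A : V →ₗ[ℝ] W)
    (v : V) (w : W) :
    inner ℝ (Cof oV oW A v) w = oV.volumeForm (stdFrame d V) * ∑ i, inner ℝ v (stdFrame d V i) *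
      oW.volumeForm (Function.update (A ∘ stdFrame d V) i w) := by
  cases d with
  | zero =>
    have : Subsingleton V := Module.finrank_zero_iff.1 hV.out
    simp [Subsingleton.elim v 0]
  | succ k =>
    have Cof_apply : Cof oV oW A v = ((-1 : ℝ) ^ k) • exteriorPower.oneEquiv ℝ W
        (hodgeStar oW k 1 (exteriorPower.map k A
          (hodgeStar oV 1 k ((exteriorPower.oneEquiv ℝ V).symm v)))) := rfl
    rw [Cof_apply, hodgeStar_oneEquiv_symm]
    simp only [map_sum, map_smul, exteriorPower.map_apply_ιMulti, real_inner_smul_left, sum_inner,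
      inner_oneEquiv_hodgeStar, Finset.mul_sum]
    refine Finset.sum_congr rfl fun i _ ↦ ?_
    have snoc_eq : (Fin.snoc (A ∘ (stdFrame (k + 1) V ∘ i.succAbove)) w : Fin (k + 1) → W) =
        (Fin.last k).insertNth w (A ∘ (stdFrame (k + 1) V ∘ i.succAbove)) := by
      rw [Fin.insertNth_last']
    have update_eq : Function.update (A ∘ stdFrame (k + 1) V) i w =
        i.insertNth w (A ∘ (stdFrame (k + 1) V ∘ i.succAbove)) := by
      rw [← Fin.insertNth_removeNth]
      rfl
    have insert_v : (-1 : ℝ) ^ (i : ℕ) *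
        oV.volumeForm (Matrix.vecCons v (stdFrame (k + 1) V ∘ i.succAbove)) =
          inner ℝ v (stdFrame (k + 1) V i) * oV.volumeForm (stdFrame (k + 1) V) := by
      have update_v := alternatingMap_update_basis oV.volumeForm (stdFrame (k + 1) V).toBasis i v
      rw [OrthonormalBasis.coe_toBasis, ← Fin.insertNth_removeNth, AlternatingMap.map_insertNth,
        OrthonormalBasis.coe_toBasis_repr_apply, OrthonormalBasis.repr_apply_apply,
        real_inner_comm, zsmul_eq_mul, Int.cast_pow, Int.cast_neg, Int.cast_one] at update_v
      exact update_v
    rw [snoc_eq, update_eq, AlternatingMap.map_insertNth, AlternatingMap.map_insertNth]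
    simp only [zsmul_eq_mul, Int.cast_pow, Int.cast_neg, Int.cast_one, Fin.val_last]
    set P := oV.volumeForm (Matrix.vecCons v (stdFrame (k + 1) V ∘ i.succAbove))
    set Q := oW.volumeForm (Matrix.vecCons w (A ∘ (stdFrame (k + 1) V ∘ i.succAbove)))
    have sq_neg_one_pow (n : ℕ) : ((-1 : ℝ) ^ n) * (-1) ^ n = 1 := by
      rw [← mul_pow]
      simp
    linear_combination (P * Q) * sq_neg_one_pow k - (P * Q) * sq_neg_one_pow i +
      (-1 : ℝ) ^ (i : ℕ) * Q * insert_v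

lemma volumeForm_smul_adjoint_Cof (oV : Orientation ℝ V (Fin d)) (oW : Orientation ℝ W (Fin d))
    (A : V →ₗ[ℝ] W) (b : Module.Basis (Fin d) ℝ V) (w : W) :
    oV.volumeForm b • LinearMap.adjoint (Cof oV oW A) w =
      ∑ i, oW.volumeForm (Function.update (A ∘ b) i w) • b i := by
  refine ext_inner_left ℝ fun v ↦ ?_
  let Θ := substitutionForm oW.volumeForm A (innerₗ V v) w
  have inner_Cof_eq : inner ℝ (Cof oV oW A v) w =
      oV.volumeForm (stdFrame d V) * Θ (stdFrame d V) := by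
    rw [inner_Cof, substitutionForm_apply]
    simp only [innerₗ_apply_apply]
  calc inner ℝ v (oV.volumeForm b • LinearMap.adjoint (Cof oV oW A) w)
      = oV.volumeForm b * (oV.volumeForm (stdFrame d V) * Θ (stdFrame d V)) := by
        rw [inner_smul_right, LinearMap.adjoint_inner_right, inner_Cof_eq]
    _ = (stdFrame d V).toBasis.det b * Θ (stdFrame d V) := by
        rw [alternatingMap_apply_eq_det_mul oV.volumeForm (stdFrame d V).toBasis b,
          OrthonormalBasis.coe_toBasis]
        linear_combination ((stdFrame d V).toBasis.det b * Θ (stdFrame d V)) *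
          volumeForm_stdFrame_mul_self oV
    _ = Θ b := by
        rw [alternatingMap_apply_eq_det_mul Θ (stdFrame d V).toBasis b,
          OrthonormalBasis.coe_toBasis]
    _ = inner ℝ v (∑ i, oW.volumeForm (Function.update (A ∘ b) i w) • b i) := by
        simp only [Θ, substitutionForm_apply, inner_sum, inner_smul_right, innerₗ_apply_apply,
          mul_comm]

lemma comp_adjoint_Cof (oV : Orientation ℝ V (Fin d)) (oW : Orientation ℝ W (Fin d))
    (A : V →ₗ[ℝ] W) (w : W) : A (LinearMap.adjoint (Cof oV oW A) w) = Det oV oW A • w := by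
  refine smul_right_injective W (volumeForm_basis_ne_zero oV (stdFrame d V).toBasis) ?_
  dsimp only
  rw [← map_smul, volumeForm_smul_adjoint_Cof, map_sum, smul_smul, volumeForm_mul_Det,
    ← sum_alternatingMap_update_smul oW.volumeForm (stdFrame d W).toBasis]
  simp

lemma adjoint_Cof_id (o : Orientation ℝ V (Fin d)) (v : V) :
    LinearMap.adjoint (Cof o o LinearMap.id) v = v := by
  have Det_id : Det o o LinearMap.id = 1 :=
    mul_left_cancel₀ (volumeForm_basis_ne_zero o (stdFrame d V).toBasis)
      (by rw [volumeForm_mul_Det, LinearMap.id_coe, Function.id_comp, mul_one])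
  simpa [Det_id] using comp_adjoint_Cof o o LinearMap.id v

lemma sum_inner_stdOrthonormalBasis (L A : V →ₗ[ℝ] W) :
    ∑ i, inner ℝ (L (stdOrthonormalBasis ℝ V i)) (A (stdOrthonormalBasis ℝ V i)) =
      LinearMap.trace ℝ V (LinearMap.adjoint A ∘ₗ L) := by
  rw [LinearMap.trace_eq_sum_inner _ (stdOrthonormalBasis ℝ V)]
  refine Finset.sum_congr rfl fun i _ ↦ ?_
  rw [real_inner_comm, LinearMap.comp_apply, LinearMap.adjoint_inner_right]

lemma volumeForm_mul_trace_adjoint_Cof_comp (oV : Orientation ℝ V (Fin d))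
    (oW : Orientation ℝ W (Fin d)) (A L : V →ₗ[ℝ] W) (b : Module.Basis (Fin d) ℝ V) :
    oV.volumeForm b * LinearMap.trace ℝ V (LinearMap.adjoint (Cof oV oW A) ∘ₗ L) =
      ∑ i, oW.volumeForm (Function.update (A ∘ b) i (L (b i))) := by
  rw [LinearMap.trace_eq_matrix_trace ℝ b, Matrix.trace, Finset.mul_sum]
  refine Finset.sum_congr rfl fun i _ ↦ ?_
  rw [Matrix.diag_apply, LinearMap.toMatrix_apply, LinearMap.comp_apply, ← smul_eq_mul,
    ← Finsupp.smul_apply, ← map_smul, volumeForm_smul_adjoint_Cof]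
  simp [Finsupp.single_apply]

end HodgeDuals

section FlatPiolaIdentity

variable {E E' : Type*} [NormedAddCommGroup E] [NormedSpace ℝ E] [NormedAddCommGroup E']
  [NormedSpace ℝ E'] {s : Set E'} {x : E'}

lemma hasFDerivWithinAt_alternatingMap_update {ι : Type*} [Fintype ι] [DecidableEq ι]
    {N : Type*} [NormedAddCommGroup N] [NormedSpace ℝ N] (ν : E [⋀^ι]→L[ℝ] N)
    {c : ι → E' → E} {c' : ι → E' →L[ℝ] E} {σ : E' → E} {σ' : E' →L[ℝ] E} (i : ι)
    (hc : ∀ j, HasFDerivWithinAt (c j) (c' j) s x) (hσ : HasFDerivWithinAt σ σ' s x) :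
    HasFDerivWithinAt (fun y ↦ ν (Function.update (fun j ↦ c j y) i (σ y)))
      (ν.toContinuousMultilinearMap.toContinuousLinearMap (fun j ↦ c j x) i ∘L σ' +
        ∑ k ∈ Finset.univ.erase i, ν.toContinuousMultilinearMap.toContinuousLinearMap
          (Function.update (fun j ↦ c j x) i (σ x)) k ∘L c' k) s x := by
  have hasFDerivWithinAt_arg (k : ι) :
      HasFDerivWithinAt (fun y ↦ Function.update (fun j ↦ c j y) i (σ y) k)
        (Function.update c' i σ' k) s x := by
    rcases eq_or_ne k i with rfl | hk
    · simpa using hσ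
    · simpa [hk] using hc k
  refine (HasFDerivWithinAt.multilinear_comp ν.toContinuousMultilinearMap
    hasFDerivWithinAt_arg).congr_fderiv ?_
  rw [← Finset.add_sum_erase _ _ (Finset.mem_univ i)]
  congr 1
  · ext v
    simp
  · exact Finset.sum_congr rfl fun k hk ↦ by rw [Function.update_of_ne (Finset.ne_of_mem_erase hk)]

lemma hasFDerivWithinAt_fderivWithin_apply {φ : E' → E} (hs : UniqueDiffOn ℝ s) (hx : x ∈ s)
    (hφ : ContDiffWithinAt ℝ 2 φ s x) (u : E') :
    HasFDerivWithinAt (fun y ↦ fderivWithin ℝ φ s y u)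
      (ContinuousLinearMap.apply ℝ E u ∘L fderivWithin ℝ (fderivWithin ℝ φ s) s x) s x :=
  (ContinuousLinearMap.apply ℝ E u).hasFDerivAt.comp_hasFDerivWithinAt x
    ((hφ.fderivWithin_right hs (m := 1) (by norm_num) hx).differentiableWithinAt
      one_ne_zero).hasFDerivWithinAt

lemma sum_fderivWithin_alternatingMap_update {ι : Type*} [Fintype ι] [DecidableEq ι]
    {N : Type*} [NormedAddCommGroup N] [NormedSpace ℝ N] (ν : E [⋀^ι]→L[ℝ] N) (u : ι → E')
    {φ σ : E' → E} (hs : UniqueDiffOn ℝ s) (hx_closure : x ∈ closure (interior s)) (hx : x ∈ s)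
    (hφ : ContDiffWithinAt ℝ 2 φ s x) (hσ : DifferentiableWithinAt ℝ σ s x) :
    ∑ i, fderivWithin ℝ
        (fun y ↦ ν (Function.update (fun j ↦ fderivWithin ℝ φ s y (u j)) i (σ y))) s x (u i) =
      ∑ i, ν (Function.update (fun j ↦ fderivWithin ℝ φ s x (u j)) i
        (fderivWithin ℝ σ s x (u i))) := by
  have symm : IsSymmSndFDerivWithinAt ℝ φ s x :=
    hφ.isSymmSndFDerivWithinAt (by simp [minSmoothness_of_isRCLikeNormedField]) hs hx_closure hx
  have deriv_eq (i : ι) := (hasFDerivWithinAt_alternatingMap_update ν i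
    (fun j ↦ hasFDerivWithinAt_fderivWithin_apply hs hx hφ (u j))
    hσ.hasFDerivWithinAt).fderivWithin (hs x hx)
  simp only [deriv_eq, add_apply, sum_apply, ContinuousLinearMap.comp_apply,
    ContinuousMultilinearMap.toContinuousLinearMap_apply, Finset.sum_add_distrib,
    ContinuousLinearMap.apply_apply]
  -- The second-order terms cancel in pairs: `D²φ` is symmetric and `ν` is alternating.
  refine add_eq_left.2 ?_
  exact sum_alternatingMap_update_update_eq_zero ν.toAlternatingMap _ (σ x)
    fun i k ↦ symm (u i) (u k)

lemma sum_fderivWithin_weighted_alternatingMap_update {d : ℕ} (b : Module.Basis (Fin d) ℝ E)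
    (ν : E [⋀^Fin d]→L[ℝ] ℝ) (u : Fin d → E') {φ σ : E' → E} {w : E → ℝ} {t : Set E}
    (hs : UniqueDiffOn ℝ s) (hx_closure : x ∈ closure (interior s)) (hx : x ∈ s)
    (hφ : ContDiffWithinAt ℝ 2 φ s x) (hσ : DifferentiableWithinAt ℝ σ s x)
    (hst : MapsTo φ s t) (hw : DifferentiableWithinAt ℝ w t (φ x)) :
    ∑ i, fderivWithin ℝ (fun y ↦ w (φ y) *
        ν (Function.update (fun j ↦ fderivWithin ℝ φ s y (u j)) i (σ y))) s x (u i) =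
      w (φ x) * ∑ i, ν (Function.update (fun j ↦ fderivWithin ℝ φ s x (u j)) i
        (fderivWithin ℝ σ s x (u i))) +
      ν (fun j ↦ fderivWithin ℝ φ s x (u j)) * fderivWithin ℝ w t (φ x) (σ x) := by
  have hwφ : HasFDerivWithinAt (fun y ↦ w (φ y))
      (fderivWithin ℝ w t (φ x) ∘L fderivWithin ℝ φ s x) s x :=
    hw.hasFDerivWithinAt.comp x (hφ.differentiableWithinAt two_ne_zero).hasFDerivWithinAt hst
  have leibniz (i : Fin d) : fderivWithin ℝ (fun y ↦ w (φ y) *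
        ν (Function.update (fun j ↦ fderivWithin ℝ φ s y (u j)) i (σ y))) s x (u i) =
      w (φ x) * fderivWithin ℝ (fun y ↦
        ν (Function.update (fun j ↦ fderivWithin ℝ φ s y (u j)) i (σ y))) s x (u i) +
      fderivWithin ℝ w t (φ x) (fderivWithin ℝ φ s x (u i)) *
        ν (Function.update (fun j ↦ fderivWithin ℝ φ s x (u j)) i (σ x)) := by
    have hν := (hasFDerivWithinAt_alternatingMap_update ν i
      (fun j ↦ hasFDerivWithinAt_fderivWithin_apply hs hx hφ (u j))
      hσ.hasFDerivWithinAt).differentiableWithinAt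
    rw [(hwφ.fun_mul hν.hasFDerivWithinAt).fderivWithin (hs x hx)]
    simp only [add_apply, smul_apply, smul_eq_mul, ContinuousLinearMap.comp_apply]
    ring
  simp only [leibniz, Finset.sum_add_distrib, ← Finset.mul_sum,
    sum_fderivWithin_alternatingMap_update ν u hs hx_closure hx hφ hσ]
  congr 1
  exact sum_mul_alternatingMap_update ν.toAlternatingMap b
    (fderivWithin ℝ w t (φ x)).toLinearMap (σ x) _

end FlatPiolaIdentity

section Orientations

variable {d : ℕ}
  {V : Type*} [NormedAddCommGroup V] [InnerProductSpace ℝ V] [FiniteDimensional ℝ V]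
  [Fact (Module.finrank ℝ V = d)]
  {W : Type*} [NormedAddCommGroup W] [InnerProductSpace ℝ W] [FiniteDimensional ℝ W]
  [Fact (Module.finrank ℝ W = d)]

lemma volumeForm_ne_zero (o : Orientation ℝ V (Fin d)) : o.volumeForm ≠ 0 := fun h ↦
  volumeForm_basis_ne_zero o (stdFrame d V).toBasis (by rw [h, AlternatingMap.zero_apply])

lemma rayOfNeZero_volumeForm (o : Orientation ℝ V (Fin d)) :
    rayOfNeZero ℝ o.volumeForm (volumeForm_ne_zero o) = o := by
  by_cases h : (stdFrame d V).toBasis.orientation = o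
  · conv_rhs => rw [← h]
    simp only [o.volumeForm_robust _ h, Module.Basis.orientation]
  · have h' := ((stdFrame d V).toBasis.orientation_ne_iff_eq_neg o).1 (Ne.symm h)
    conv_rhs => rw [h']
    simp only [o.volumeForm_robust_neg _ h, Module.Basis.orientation, neg_rayOfNeZero]

lemma volumeForm_mul_volumeForm_map_pos (o : Orientation ℝ V (Fin d)) (L : V ≃ₗ[ℝ] W)
    (b : Module.Basis (Fin d) ℝ V) :
    0 < o.volumeForm b * (Orientation.map (Fin d) L o).volumeForm (L ∘ b) := by
  have same_ray : SameRay ℝ (o.volumeForm.compLinearMap L.symm.toLinearMap)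
      (Orientation.map (Fin d) L o).volumeForm := by
    have h := Orientation.map_apply (Fin d) L o.volumeForm (volumeForm_ne_zero o)
    simp only [rayOfNeZero_volumeForm] at h
    rw [← rayOfNeZero_volumeForm (Orientation.map (Fin d) L o)] at h
    exact ((ray_eq_iff _ _).1 h).symm
  obtain ⟨r, s, hr, hs, hrs⟩ := same_ray.exists_pos
    (fun h ↦ volumeForm_basis_ne_zero o b (by simpa using congr($h (L ∘ b))))
    (volumeForm_ne_zero _)
  have hb : r * o.volumeForm b = s * (Orientation.map (Fin d) L o).volumeForm (L ∘ b) := by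
    simpa [Function.comp_def] using congr($hrs (L ∘ b))
  have : 0 < s * (o.volumeForm b * (Orientation.map (Fin d) L o).volumeForm (L ∘ b)) := by
    rw [mul_left_comm, ← hb]
    nlinarith [pow_pos hr 2, sq_pos_of_ne_zero (volumeForm_basis_ne_zero o b)]
  exact pos_of_mul_pos_right this hs.le
end Orientations

/-! ### Charts and coordinate frames -/

section Charts

variable {E : Type*} [NormedAddCommGroup E] [NormedSpace ℝ E]
  {H : Type*} [TopologicalSpace H] {I : ModelWithCorners ℝ E H}
  {M : Type*} [TopologicalSpace M] [ChartedSpace H M] {p q : M}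

lemma extChartAt_mem_target (hq : q ∈ (chartAt H p).source) :
    extChartAt I p q ∈ (extChartAt I p).target :=
  (extChartAt I p).map_source (by rwa [extChartAt_source])

lemma extChartAt_symm_apply (hq : q ∈ (chartAt H p).source) :
    (extChartAt I p).symm (extChartAt I p q) = q :=
  (extChartAt I p).left_inv (by rwa [extChartAt_source])

lemma extChartAt_symm_mem_source {x : E} (hx : x ∈ (extChartAt I p).target) :
    (extChartAt I p).symm x ∈ (chartAt H p).source := by
  simpa only [extChartAt_source] using (extChartAt I p).map_target hx

lemma extChartAt_mem_range : extChartAt I p q ∈ range I := by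
  rw [extChartAt_coe]
  exact mem_range_self _

lemma uniqueDiffWithinAt_extChartAt : UniqueDiffWithinAt ℝ (range I) (extChartAt I p q) :=
  I.uniqueDiffOn _ extChartAt_mem_range

lemma contDiffWithinAt_comp_extChartAt_symm {F : Type*} [NormedAddCommGroup F] [NormedSpace ℝ F]
    [IsManifold I ∞ M] {h : M → F} (hq : q ∈ (chartAt H p).source)
    (hh : ContMDiffAt I 𝓘(ℝ, F) ∞ h q) :
    ContDiffWithinAt ℝ ∞ (h ∘ (extChartAt I p).symm) (range I) (extChartAt I p q) :=
  ((contMDiffAt_iff_source_of_mem_source hq).1 hh).contDiffWithinAt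

end Charts

section Coordinates

variable {d : ℕ}
  {H : Type*} [TopologicalSpace H] (I : ModelWithCorners ℝ (EuclideanSpace ℝ (Fin d)) H)
  {M : Type*} [TopologicalSpace M] [ChartedSpace H M] [IsManifold I 1 M]

/-- The coordinates of a tangent vector at `q` in the chart around `p`. -/
def toCoord (p q : M) : TangentSpace I q →L[ℝ] EuclideanSpace ℝ (Fin d) :=
  (trivializationAt (EuclideanSpace ℝ (Fin d)) (TangentSpace I (M := M))
    p).continuousLinearMapAt ℝ q

/-- The tangent vector at `q` with given coordinates in the chart around `p`. -/
def ofCoord (p q : M) : EuclideanSpace ℝ (Fin d) →L[ℝ] TangentSpace I q :=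
  (trivializationAt (EuclideanSpace ℝ (Fin d)) (TangentSpace I (M := M)) p).symmL ℝ q

variable {I} {p q : M}

lemma toCoord_apply (hq : q ∈ (chartAt H p).source) (v : TangentSpace I q) :
    toCoord I p q v =
      (trivializationAt (EuclideanSpace ℝ (Fin d)) (TangentSpace I (M := M)) p ⟨q, v⟩).2 :=
  Trivialization.continuousLinearMapAt_apply_of_mem ℝ _ hq v

lemma ofCoord_apply (hq : q ∈ (chartAt H p).source) (v : EuclideanSpace ℝ (Fin d)) :
    ofCoord I p q v =
      (trivializationAt (EuclideanSpace ℝ (Fin d)) (TangentSpace I (M := M)) p).symm q v :=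
  Trivialization.symmL_apply _ hq v

lemma toCoord_ofCoord (hq : q ∈ (chartAt H p).source) (v : EuclideanSpace ℝ (Fin d)) :
    toCoord I p q (ofCoord I p q v) = v :=
  Trivialization.continuousLinearMapAt_symmL _ hq v

lemma ofCoord_toCoord (hq : q ∈ (chartAt H p).source) (v : TangentSpace I q) :
    ofCoord I p q (toCoord I p q v) = v :=
  Trivialization.symmL_continuousLinearMapAt _ hq v

lemma toCoord_eq_mfderiv (hq : q ∈ (chartAt H p).source) :
    toCoord I p q = mfderiv I 𝓘(ℝ, EuclideanSpace ℝ (Fin d)) (extChartAt I p) q :=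
  TangentBundle.continuousLinearMapAt_trivializationAt hq

lemma ofCoord_eq_mfderivWithin (hq : q ∈ (chartAt H p).source) :
    ofCoord I p q = mfderivWithin 𝓘(ℝ, EuclideanSpace ℝ (Fin d)) I (extChartAt I p).symm
      (range I) (extChartAt I p q) :=
  TangentBundle.symmL_trivializationAt hq

lemma coordVector_eq (hq : q ∈ (chartAt H p).source) (i : Fin d) :
    coordVector I p q i = ofCoord I p q (EuclideanSpace.single i 1) :=
  (ofCoord_apply hq _).symm

lemma extend_eq (hq : q ∈ (chartAt H p).source) (v : TangentSpace I p) :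
    FiberBundle.extend (EuclideanSpace ℝ (Fin d)) v q = ofCoord I p q (toCoord I p p v) := by
  rw [ofCoord_apply hq, toCoord_apply (mem_chart_source H p)]
  rfl

lemma toCoord_extend (hq : q ∈ (chartAt H p).source) (v : TangentSpace I p) :
    toCoord I p q (FiberBundle.extend (EuclideanSpace ℝ (Fin d)) v q) = toCoord I p p v := by
  rw [extend_eq hq, toCoord_ofCoord hq]

/-- The coordinate frame of the chart around `p`, as a basis of the tangent space at `q`. -/
def coordBasis (hq : q ∈ (chartAt H p).source) : Module.Basis (Fin d) ℝ (TangentSpace I q) :=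
  (EuclideanSpace.basisFun (Fin d) ℝ).toBasis.map
    (LinearEquiv.ofLinearMap (ofCoord I p q).toLinearMap (toCoord I p q).toLinearMap
      (LinearMap.ext fun v ↦ ofCoord_toCoord hq v) (LinearMap.ext fun v ↦ toCoord_ofCoord hq v))

lemma coe_coordBasis (hq : q ∈ (chartAt H p).source) :
    ⇑(coordBasis hq) = coordVector I p q := by
  ext1 i
  rw [coordVector_eq hq]
  simp [coordBasis]

lemma coordBasis_repr (hq : q ∈ (chartAt H p).source) (v : TangentSpace I q) (i : Fin d) :
    (coordBasis hq).repr v i = toCoord I p q v i := by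
  simp [coordBasis]

lemma mvfderiv_ofCoord {F : Type*} [NormedAddCommGroup F] [NormedSpace ℝ F] {h : M → F}
    (hq : q ∈ (chartAt H p).source) (hh : MDifferentiableAt I 𝓘(ℝ, F) h q)
    (v : EuclideanSpace ℝ (Fin d)) :
    mvfderiv I h q (ofCoord I p q v) =
      fderivWithin ℝ (h ∘ (extChartAt I p).symm) (range I) (extChartAt I p q) v := by
  have chain_rule := mfderiv_comp_mfderivWithin_of_eq
    (I := 𝓘(ℝ, EuclideanSpace ℝ (Fin d))) (I'' := 𝓘(ℝ, F)) hh
    (mdifferentiableWithinAt_extChartAt_symm (extChartAt_mem_target hq))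
    (uniqueDiffWithinAt_extChartAt.uniqueMDiffWithinAt) (extChartAt_symm_apply hq)
  rw [mfderivWithin_eq_fderivWithin] at chain_rule
  rw [ofCoord_eq_mfderivWithin hq]
  exact congr($chain_rule.symm v)

end Coordinates

section CoordinatesOfMaps

variable {d : ℕ}
  {H₁ : Type*} [TopologicalSpace H₁] {I₁ : ModelWithCorners ℝ (EuclideanSpace ℝ (Fin d)) H₁}
  {M₁ : Type*} [TopologicalSpace M₁] [ChartedSpace H₁ M₁] [IsManifold I₁ 1 M₁]
  {H₂ : Type*} [TopologicalSpace H₂] {I₂ : ModelWithCorners ℝ (EuclideanSpace ℝ (Fin d)) H₂}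
  {M₂ : Type*} [TopologicalSpace M₂] [ChartedSpace H₂ M₂] [IsManifold I₂ 1 M₂]

lemma toCoord_mfderiv_ofCoord {f : M₁ → M₂} {p q : M₁} {y : M₂} (hq : q ∈ (chartAt H₁ p).source)
    (hy : f q ∈ (chartAt H₂ y).source) (hf : MDifferentiableAt I₁ I₂ f q)
    (v : EuclideanSpace ℝ (Fin d)) :
    toCoord I₂ y (f q) (mfderiv I₁ I₂ f q (ofCoord I₁ p q v)) =
      fderivWithin ℝ (extChartAt I₂ y ∘ f ∘ (extChartAt I₁ p).symm) (range I₁)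
        (extChartAt I₁ p q) v := by
  have hc : MDifferentiableAt I₂ 𝓘(ℝ, EuclideanSpace ℝ (Fin d)) (extChartAt I₂ y) (f q) :=
    mdifferentiableAt_extChartAt hy
  have chain_rule := mfderiv_comp q hc hf
  rw [toCoord_eq_mfderiv hy]
  exact congr($chain_rule.symm (ofCoord I₁ p q v)).trans (mvfderiv_ofCoord hq (hc.comp q hf) v)

end CoordinatesOfMaps

section SmoothSections

variable {d : ℕ}
  {H : Type*} [TopologicalSpace H] {I : ModelWithCorners ℝ (EuclideanSpace ℝ (Fin d)) H}
  {M : Type*} [TopologicalSpace M] [ChartedSpace H M] [IsManifold I ∞ M]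
  {EN : Type*} [NormedAddCommGroup EN] [NormedSpace ℝ EN]
  {HN : Type*} [TopologicalSpace HN] {IN : ModelWithCorners ℝ EN HN}
  {N : Type*} [TopologicalSpace N] [ChartedSpace HN N]

lemma contMDiffAt_along_iff {b : N → M} {σ : ∀ n, TangentSpace I (b n)} {n₀ : N} {p : M}
    (hp : b n₀ ∈ (chartAt H p).source) :
    ContMDiffAt IN I.tangent ∞ (fun n ↦ (⟨b n, σ n⟩ : TangentBundle I M)) n₀ ↔
      ContMDiffAt IN I ∞ b n₀ ∧
      ContMDiffAt IN 𝓘(ℝ, EuclideanSpace ℝ (Fin d)) ∞ (fun n ↦ toCoord I p (b n) (σ n)) n₀ := by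
  refine ((trivializationAt _ (TangentSpace I (M := M)) p).contMDiffAt_iff
    (f := fun n ↦ (⟨b n, σ n⟩ : TangentBundle I M))
    (by rwa [Trivialization.mem_source])).trans (and_congr_right fun hb ↦ ?_)
  refine Filter.EventuallyEq.contMDiffAt_iff ?_
  filter_upwards [hb.continuousAt.preimage_mem_nhds ((chartAt H p).open_source.mem_nhds hp)]
    with n hn
  exact (toCoord_apply hn _).symm

lemma contMDiffAt_coordVector {p q : M} (hq : q ∈ (chartAt H p).source) (i : Fin d) :
    ContMDiffAt I I.tangent ∞ (fun q ↦ (⟨q, coordVector I p q i⟩ : TangentBundle I M)) q := by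
  refine (contMDiffAt_along_iff (b := fun q ↦ q) hq).2 ⟨contMDiffAt_id, ?_⟩
  refine (contMDiffAt_const (c := EuclideanSpace.single i (1 : ℝ))).congr_of_eventuallyEq ?_
  filter_upwards [(chartAt H p).open_source.mem_nhds hq] with x hx
  rw [coordVector_eq hx, toCoord_ofCoord hx]

end SmoothSections

section VolumeInCoordinates

variable {d : ℕ}
  {H : Type*} [TopologicalSpace H] {I : ModelWithCorners ℝ (EuclideanSpace ℝ (Fin d)) H}
  {M : Type*} [TopologicalSpace M] [ChartedSpace H M]

variable (d) in
/-- The determinant with respect to the standard basis, as a continuous alternating form on the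
model space. -/
def stdDet : EuclideanSpace ℝ (Fin d) [⋀^Fin d]→L[ℝ] ℝ where
  toAlternatingMap := (EuclideanSpace.basisFun (Fin d) ℝ).toBasis.det
  cont := by
    change Continuous fun m : Fin d → EuclideanSpace ℝ (Fin d) ↦ (Matrix.of fun i j ↦ m j i).det
    fun_prop

lemma contMDiffAt_stdDet {EN : Type*} [NormedAddCommGroup EN] [NormedSpace ℝ EN]
    {HN : Type*} [TopologicalSpace HN] {IN : ModelWithCorners ℝ EN HN}
    {N : Type*} [TopologicalSpace N] [ChartedSpace HN N]
    {c : Fin d → N → EuclideanSpace ℝ (Fin d)} {n : N}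
    (hc : ∀ i, ContMDiffAt IN 𝓘(ℝ, EuclideanSpace ℝ (Fin d)) ∞ (c i) n) :
    ContMDiffAt IN 𝓘(ℝ, ℝ) ∞ (fun x ↦ stdDet d fun i ↦ c i x) n :=
  (stdDet d).toContinuousMultilinearMap.contDiff.contMDiff.contMDiffAt.comp n
    (contMDiffAt_pi_space.2 hc)

variable (I) [IsManifold I 1 M] [RiemannianBundle (fun x : M ↦ TangentSpace I x)]

/-- The Gram determinant `det (g_ij)` of the coordinate frame of the chart around `p`. -/
def gramDet (p q : M) : ℝ :=
  (Matrix.gram ℝ (coordVector I p q)).det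

variable {I}

/-- The value of the Riemannian volume form on the coordinate frame of the chart around `p`. -/
def coordVol (o : ManifoldOrientation I M) (p q : M) : ℝ :=
  (o.or q).volumeForm (coordVector I p q)

lemma coordVol_sq (o : ManifoldOrientation I M) (p q : M) : coordVol o p q ^ 2 = gramDet I p q :=
  volumeForm_sq _ _

lemma coordVol_ne_zero (o : ManifoldOrientation I M) {p q : M} (hq : q ∈ (chartAt H p).source) :
    coordVol o p q ≠ 0 := by
  rw [coordVol, ← coe_coordBasis hq]
  exact volumeForm_basis_ne_zero _ _

lemma gramDet_pos {p q : M} (hq : q ∈ (chartAt H p).source) : 0 < gramDet I p q := by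
  let o : Orientation ℝ (TangentSpace I q) (Fin d) := (coordBasis hq).orientation
  have hvol := volumeForm_basis_ne_zero o (coordBasis hq)
  rw [gramDet, ← coe_coordBasis hq, ← volumeForm_sq o]
  positivity

lemma volumeForm_eq_coordVol_mul_stdDet (o : ManifoldOrientation I M) {p q : M}
    (hq : q ∈ (chartAt H p).source) (v : Fin d → TangentSpace I q) :
    (o.or q).volumeForm v = coordVol o p q * stdDet d fun i ↦ toCoord I p q (v i) := by
  rw [alternatingMap_apply_eq_det_mul (o.or q).volumeForm (coordBasis hq), coe_coordBasis,
    mul_comm, Module.Basis.det_apply]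
  rfl

lemma eventually_coordVol_eq (o : ManifoldOrientation I M) (p : M) :
    ∃ ε : ℝ, ∀ᶠ q in 𝓝 p, coordVol o p q = ε * √(gramDet I p q) := by
  obtain ⟨c, hc⟩ := o.locally_constant p
  have : Fact (Module.finrank ℝ (EuclideanSpace ℝ (Fin d)) = d) := ⟨finrank_euclideanSpace_fin⟩
  let e := EuclideanSpace.basisFun (Fin d) ℝ
  have sq_eq_one : c.volumeForm e ^ 2 = 1 := by
    rw [volumeForm_sq, Matrix.gram_eq_one_iff_orthonormal.2 e.orthonormal, Matrix.det_one]
  refine ⟨c.volumeForm e, ?_⟩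
  filter_upwards [hc, (chartAt H p).open_source.mem_nhds (mem_chart_source H p)] with q hcq hq
  have same_sign := volumeForm_mul_volumeForm_map_pos (o.or q)
    ((trivializationAt (EuclideanSpace ℝ (Fin d)) (TangentSpace I (M := M))
      p).continuousLinearEquivAt ℝ q hq).toLinearEquiv (coordBasis hq)
  have image_frame : ((trivializationAt (EuclideanSpace ℝ (Fin d)) (TangentSpace I (M := M))
      p).continuousLinearEquivAt ℝ q hq).toLinearEquiv ∘ coordBasis hq = e := by
    ext1 i
    rw [Function.comp_apply, coe_coordBasis, coordVector_eq hq, EuclideanSpace.basisFun_apply]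
    exact (toCoord_apply (I := I) hq _).symm.trans (toCoord_ofCoord hq _)
  rw [hcq hq, image_frame, coe_coordBasis] at same_sign
  have sqrt_eq : √(gramDet I p q) = c.volumeForm e * coordVol o p q := by
    rw [← coordVol_sq o, ← one_mul (_ ^ 2), ← sq_eq_one, ← mul_pow,
      Real.sqrt_sq (by rw [mul_comm]; exact same_sign.le)]
  rw [sqrt_eq, ← mul_assoc, ← sq, sq_eq_one, one_mul]

end VolumeInCoordinates

section SmoothVolume

variable {d : ℕ}
  {H : Type*} [TopologicalSpace H] {I : ModelWithCorners ℝ (EuclideanSpace ℝ (Fin d)) H}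
  {M : Type*} [TopologicalSpace M] [ChartedSpace H M] [IsManifold I ∞ M]
  [RiemannianBundle (fun x : M ↦ TangentSpace I x)]
  [IsContMDiffRiemannianBundle I ∞ (EuclideanSpace ℝ (Fin d)) (fun x : M ↦ TangentSpace I x)]

lemma contMDiffAt_gramDet {p q : M} (hq : q ∈ (chartAt H p).source) :
    ContMDiffAt I 𝓘(ℝ, ℝ) ∞ (gramDet I p) q := by
  unfold gramDet
  simp only [Matrix.det_apply', Matrix.gram_apply]
  refine ContMDiffAt.sum fun τ _ ↦ contMDiffAt_const.mul (ContMDiffAt.prod fun i _ ↦ ?_)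
  exact ContMDiffAt.inner_bundle (IB := I) (E := fun x : M ↦ TangentSpace I x) (b := fun x ↦ x)
    (contMDiffAt_coordVector hq _) (contMDiffAt_coordVector hq _)

lemma contMDiffAt_coordVol (o : ManifoldOrientation I M) {p q : M}
    (hq : q ∈ (chartAt H p).source) : ContMDiffAt I 𝓘(ℝ, ℝ) ∞ (coordVol o p) q := by
  have at_centre : ContMDiffAt I 𝓘(ℝ, ℝ) ∞ (coordVol o q) q := by
    obtain ⟨ε, hε⟩ := eventually_coordVol_eq o q
    have hsqrt : ContDiffAt ℝ ∞ Real.sqrt (gramDet I q q) :=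
      Real.contDiffAt_sqrt (gramDet_pos (mem_chart_source H q)).ne'
    exact (contMDiffAt_const.mul (hsqrt.contMDiffAt.comp q
      (contMDiffAt_gramDet (mem_chart_source H q)))).congr_of_eventuallyEq hε
  have change_of_chart : coordVol o p =ᶠ[𝓝 q] fun x ↦
      coordVol o q x * stdDet d fun i ↦ toCoord I q x (coordVector I p x i) := by
    filter_upwards [(chartAt H q).open_source.mem_nhds (mem_chart_source H q)] with x hx
    exact volumeForm_eq_coordVol_mul_stdDet o hx _
  refine (at_centre.mul (contMDiffAt_stdDet fun i ↦ ?_)).congr_of_eventuallyEq change_of_chart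
  exact ((contMDiffAt_along_iff (b := fun q ↦ q) (mem_chart_source H q)).1
    (contMDiffAt_coordVector hq i)).2

end SmoothVolume

/-! ### The Levi-Civita connection in coordinates -/

section LeviCivita

variable {d : ℕ}
  {H : Type*} [TopologicalSpace H] {I : ModelWithCorners ℝ (EuclideanSpace ℝ (Fin d)) H}
  {M : Type*} [TopologicalSpace M] [ChartedSpace H M] [IsManifold I ∞ M]
  [RiemannianBundle (fun x : M ↦ TangentSpace I x)]

omit [IsManifold I ∞ M] in
lemma koszul_sub_koszul_swap (U X W : ∀ q : M, TangentSpace I q) (p : M) :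
    koszul I U X W p - koszul I X U W p =
      2 * inner ℝ (VectorField.mlieBracket I U X p) (W p) := by
  simp only [koszul, VectorField.mlieBracket_swap_apply (V := X) (W := U), inner_neg_left,
    fun q ↦ real_inner_comm (U q) (X q)]
  ring

omit [IsManifold I ∞ M] in
lemma koszul_add_koszul_swap (U X W : ∀ q : M, TangentSpace I q) (p : M) :
    koszul I U X W p + koszul I U W X p =
      2 * mvfderiv I (fun q ↦ inner ℝ (X q) (W q)) p (U p) := by
  simp only [koszul, VectorField.mlieBracket_swap_apply (V := W) (W := X), inner_neg_left,
    fun q ↦ real_inner_comm (X q) (W q)]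
  ring

variable
  [IsContMDiffRiemannianBundle I ∞ (EuclideanSpace ℝ (Fin d)) (fun x : M ↦ TangentSpace I x)]
  {U V X Y W : ∀ q : M, TangentSpace I q} {f : M → ℝ} {p : M}

lemma mdifferentiableAt_inner (hX : MDiffAt (T% X) p) (hW : MDiffAt (T% W) p) :
    MDiffAt (fun q ↦ inner ℝ (X q) (W q)) p :=
  have : IsContMDiffRiemannianBundle I 1 (EuclideanSpace ℝ (Fin d))
    (fun x : M ↦ TangentSpace I x) := .of_le (n := ∞) (mod_cast le_top)
  MDifferentiableAt.inner_bundle (IB := I) (F := EuclideanSpace ℝ (Fin d))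
    (E := fun x : M ↦ TangentSpace I x) (b := fun x ↦ x) hX hW

lemma mvfderiv_inner_add_left (hX : MDiffAt (T% X) p) (hY : MDiffAt (T% Y) p)
    (hW : MDiffAt (T% W) p) :
    mvfderiv I (fun q ↦ inner ℝ ((X + Y) q) (W q)) p =
      mvfderiv I (fun q ↦ inner ℝ (X q) (W q)) p + mvfderiv I (fun q ↦ inner ℝ (Y q) (W q)) p := by
  simp only [Pi.add_apply, inner_add_left]
  exact mvfderiv_fun_add (mdifferentiableAt_inner hX hW) (mdifferentiableAt_inner hY hW)

lemma mvfderiv_inner_smul_left (hf : MDiffAt f p) (hX : MDiffAt (T% X) p)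
    (hW : MDiffAt (T% W) p) (v : TangentSpace I p) :
    mvfderiv I (fun q ↦ inner ℝ ((f • X) q) (W q)) p v =
      f p * mvfderiv I (fun q ↦ inner ℝ (X q) (W q)) p v
        + mvfderiv I f p v * inner ℝ (X p) (W p) := by
  simp only [Pi.smul_apply', real_inner_smul_left]
  rw [mvfderiv_fun_mul hf (mdifferentiableAt_inner hX hW)]
  simp [mul_comm]

lemma tensorialAt_koszul_left (hX : MDiffAt (T% X) p) (hW : MDiffAt (T% W) p) :
    TensorialAt I (EuclideanSpace ℝ (Fin d)) (fun U ↦ koszul I U X W p) p where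
  smul {f U} hf hU := by
    rw [koszul, mvfderiv_inner_smul_left hf hU hX, mvfderiv_inner_smul_left hf hU hW,
      VectorField.mlieBracket_smul_left hf hU, VectorField.mlieBracket_smul_left hf hU, koszul]
    simp only [Pi.smul_apply', map_smul, inner_add_left, real_inner_smul_left,
      real_inner_smul_right, neg_smul, inner_neg_left, smul_eq_mul]
    ring
  add {U V} hU hV := by
    rw [koszul, mvfderiv_inner_add_left hU hV hX, mvfderiv_inner_add_left hU hV hW,
      VectorField.mlieBracket_add_left hU hV, VectorField.mlieBracket_add_left hU hV, koszul,
      koszul]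
    simp only [Pi.add_apply, map_add, add_apply, inner_add_left, inner_add_right]
    ring

lemma koszul_add_middle (hU : MDiffAt (T% U) p) (hX : MDiffAt (T% X) p) (hY : MDiffAt (T% Y) p)
    (hW : MDiffAt (T% W) p) :
    koszul I U (X + Y) W p = koszul I U X W p + koszul I U Y W p := by
  have additive := (tensorialAt_koszul_left hU hW).add hX hY
  have bracket := VectorField.mlieBracket_add_right (V := U) hX hY
  have torsion (Z : ∀ q : M, TangentSpace I q) := koszul_sub_koszul_swap U Z W p
  have torsion_add := torsion (X + Y)
  rw [bracket, inner_add_left] at torsion_add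
  linear_combination torsion_add + additive - torsion X - torsion Y

lemma koszul_smul_middle (hU : MDiffAt (T% U) p) (hf : MDiffAt f p) (hX : MDiffAt (T% X) p)
    (hW : MDiffAt (T% W) p) :
    koszul I U (f • X) W p =
      f p * koszul I U X W p + 2 * mvfderiv I f p (U p) * inner ℝ (X p) (W p) := by
  have homogeneous := (tensorialAt_koszul_left hU hW).smul hf hX
  have bracket := VectorField.mlieBracket_smul_right (V := U) hf hX
  have torsion_smul := koszul_sub_koszul_swap U (f • X) W p
  rw [bracket, inner_add_left, real_inner_smul_left, real_inner_smul_left] at torsion_smul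
  rw [smul_eq_mul] at homogeneous
  linear_combination torsion_smul + homogeneous - f p * koszul_sub_koszul_swap U X W p

lemma tensorialAt_koszul_right (hU : MDiffAt (T% U) p) (hX : MDiffAt (T% X) p) :
    TensorialAt I (EuclideanSpace ℝ (Fin d)) (fun W ↦ koszul I U X W p) p where
  smul {f W} hf hW := by
    have metric := koszul_add_koszul_swap U (f • W) X p
    rw [mvfderiv_inner_smul_left hf hW hX, koszul_smul_middle hU hf hW hX] at metric
    rw [smul_eq_mul]
    linear_combination metric - f p * koszul_add_koszul_swap U W X p
  add {V W} hV hW := by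
    have metric := koszul_add_koszul_swap U (V + W) X p
    rw [mvfderiv_inner_add_left hV hW hX, add_apply, koszul_add_middle hU hV hW hX] at metric
    linear_combination metric - koszul_add_koszul_swap U V X p - koszul_add_koszul_swap U W X p

lemma two_mul_inner_leviCivita (hU : MDiffAt (T% U) p) (hX : MDiffAt (T% X) p)
    (hW : MDiffAt (T% W) p) :
    2 * inner ℝ (leviCivita I X p (U p)) (W p) = koszul I U X W p := by
  let e := stdOrthonormalBasis ℝ (TangentSpace I p)
  let T : TangentSpace I p →L[ℝ] ℝ := TensorialAt.mkHom _ p (tensorialAt_koszul_right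
    (FiberBundle.mdifferentiableAt_extend I (EuclideanSpace ℝ (Fin d)) (U p)) hX)
  calc 2 * inner ℝ (leviCivita I X p (U p)) (W p)
      = ∑ i, inner ℝ (e i) (W p) * T (e i) := by
        rw [leviCivita, sum_inner, Finset.mul_sum]
        refine Finset.sum_congr rfl fun i _ ↦ ?_
        rw [real_inner_smul_left, TensorialAt.mkHom_apply_eq_extend]
        ring
    _ = T (W p) := by
        conv_rhs => rw [← e.sum_repr' (W p)]
        simp only [map_sum, map_smul, smul_eq_mul]
    _ = koszul I (FiberBundle.extend (EuclideanSpace ℝ (Fin d)) (U p)) X W p :=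
        TensorialAt.mkHom_apply _ hW
    _ = koszul I U X W p := (tensorialAt_koszul_left hX hW).pointwise
        (FiberBundle.mdifferentiableAt_extend ..) hU (FiberBundle.extend_apply_self ..)

lemma two_mul_inner_leviCivita_extend (hX : MDiffAt (T% X) p) (u w : TangentSpace I p) :
    2 * inner ℝ (leviCivita I X p u) w =
      koszul I (FiberBundle.extend (EuclideanSpace ℝ (Fin d)) u) X
        (FiberBundle.extend (EuclideanSpace ℝ (Fin d)) w) p := by
  simpa only [FiberBundle.extend_apply_self] using two_mul_inner_leviCivita
    (FiberBundle.mdifferentiableAt_extend I (EuclideanSpace ℝ (Fin d)) u) hX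
    (FiberBundle.mdifferentiableAt_extend I (EuclideanSpace ℝ (Fin d)) w)

variable {u v w : TangentSpace I p} {c : ℝ}

lemma leviCivita_add_direction (hX : MDiffAt (T% X) p) :
    leviCivita I X p (u + v) = leviCivita I X p u + leviCivita I X p v := by
  refine ext_inner_right ℝ fun w ↦ mul_left_cancel₀ (two_ne_zero (α := ℝ)) ?_
  have additive := TensorialAt.mkHom _ p (tensorialAt_koszul_left hX
    (FiberBundle.mdifferentiableAt_extend I (EuclideanSpace ℝ (Fin d)) w)) |>.map_add u v
  simp only [TensorialAt.mkHom_apply_eq_extend] at additive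
  rw [inner_add_left, mul_add]
  simpa only [two_mul_inner_leviCivita_extend hX] using additive

lemma leviCivita_smul_direction (hX : MDiffAt (T% X) p) :
    leviCivita I X p (c • u) = c • leviCivita I X p u := by
  refine ext_inner_right ℝ fun w ↦ mul_left_cancel₀ (two_ne_zero (α := ℝ)) ?_
  have homogeneous := TensorialAt.mkHom _ p (tensorialAt_koszul_left hX
    (FiberBundle.mdifferentiableAt_extend I (EuclideanSpace ℝ (Fin d)) w)) |>.map_smul c u
  simp only [TensorialAt.mkHom_apply_eq_extend] at homogeneous
  rw [real_inner_smul_left, mul_left_comm]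
  simpa only [two_mul_inner_leviCivita_extend hX, smul_eq_mul] using homogeneous

lemma leviCivita_add_field (hX : MDiffAt (T% X) p) (hY : MDiffAt (T% Y) p) :
    leviCivita I (X + Y) p u = leviCivita I X p u + leviCivita I Y p u := by
  refine ext_inner_right ℝ fun w ↦ mul_left_cancel₀ (two_ne_zero (α := ℝ)) ?_
  rw [inner_add_left, mul_add,
    two_mul_inner_leviCivita_extend (mdifferentiableAt_add_section hX hY),
    two_mul_inner_leviCivita_extend hX, two_mul_inner_leviCivita_extend hY]
  exact koszul_add_middle (FiberBundle.mdifferentiableAt_extend ..) hX hY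
    (FiberBundle.mdifferentiableAt_extend ..)

lemma leviCivita_smul_field (hf : MDiffAt f p) (hX : MDiffAt (T% X) p) :
    leviCivita I (f • X) p u = f p • leviCivita I X p u + mvfderiv I f p u • X p := by
  refine ext_inner_right ℝ fun w ↦ mul_left_cancel₀ (two_ne_zero (α := ℝ)) ?_
  rw [inner_add_left, mul_add, real_inner_smul_left, mul_left_comm,
    two_mul_inner_leviCivita_extend (hf.smul_section hX), two_mul_inner_leviCivita_extend hX,
    koszul_smul_middle (FiberBundle.mdifferentiableAt_extend ..) hf hX
      (FiberBundle.mdifferentiableAt_extend ..)]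
  simp only [FiberBundle.extend_apply_self, real_inner_smul_left]
  ring

lemma leviCivita_sub_leviCivita (hX : MDiffAt (T% X) p) (hY : MDiffAt (T% Y) p) :
    leviCivita I Y p (X p) - leviCivita I X p (Y p) = VectorField.mlieBracket I X Y p := by
  refine ext_inner_right ℝ fun w ↦ mul_left_cancel₀ (two_ne_zero (α := ℝ)) ?_
  have hw := FiberBundle.mdifferentiableAt_extend I (EuclideanSpace ℝ (Fin d)) w
  have torsion := koszul_sub_koszul_swap X Y
    (FiberBundle.extend (EuclideanSpace ℝ (Fin d)) w) p
  rw [← two_mul_inner_leviCivita hX hY hw, ← two_mul_inner_leviCivita hY hX hw,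
    FiberBundle.extend_apply_self] at torsion
  rw [inner_sub_left, mul_sub, torsion]

lemma mvfderiv_inner (hX : MDiffAt (T% X) p) (hY : MDiffAt (T% Y) p) :
    mvfderiv I (fun q ↦ inner ℝ (X q) (Y q)) p u =
      inner ℝ (leviCivita I X p u) (Y p) + inner ℝ (X p) (leviCivita I Y p u) := by
  have hu := FiberBundle.mdifferentiableAt_extend I (EuclideanSpace ℝ (Fin d)) u
  have metric := koszul_add_koszul_swap (FiberBundle.extend (EuclideanSpace ℝ (Fin d)) u) X Y p
  rw [← two_mul_inner_leviCivita hu hX hY, ← two_mul_inner_leviCivita hu hY hX,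
    FiberBundle.extend_apply_self] at metric
  rw [real_inner_comm (leviCivita I Y p u)]
  linear_combination -metric / 2

end LeviCivita

section Christoffel

variable {d : ℕ}
  {H : Type*} [TopologicalSpace H] {I : ModelWithCorners ℝ (EuclideanSpace ℝ (Fin d)) H}
  {M : Type*} [TopologicalSpace M] [ChartedSpace H M] [IsManifold I ∞ M]

lemma mdifferentiableAt_toCoord {X : ∀ q : M, TangentSpace I q} {p : M} (hX : MDiffAt (T% X) p) :
    MDiffAt (fun q ↦ toCoord I p q (X q)) p := by
  refine ((trivializationAt (EuclideanSpace ℝ (Fin d)) (TangentSpace I (M := M))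
    p).mdifferentiableAt_section_iff I X (mem_chart_source H p)).1 hX |>.congr_of_eventuallyEq ?_
  filter_upwards [(chartAt H p).open_source.mem_nhds (mem_chart_source H p)] with q hq
  exact toCoord_apply hq _

lemma mvfderiv_toCoord_extend {p : M} (v u : TangentSpace I p) :
    mvfderiv I (fun q ↦ toCoord I p q (FiberBundle.extend (EuclideanSpace ℝ (Fin d)) v q)) p u
      = 0 := by
  have constant : (fun q ↦ toCoord I p q (FiberBundle.extend (EuclideanSpace ℝ (Fin d)) v q))
      =ᶠ[𝓝 p] fun _ ↦ toCoord I p p v := by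
    filter_upwards [(chartAt H p).open_source.mem_nhds (mem_chart_source H p)] with q hq
    exact toCoord_extend hq v
  rw [mvfderiv, constant.mfderiv_eq]
  exact congr($(mvfderiv_const (I := I) (toCoord I p p v) (x := p)) u)

lemma mlieBracket_extend {p : M} (u v : TangentSpace I p) :
    VectorField.mlieBracket I (FiberBundle.extend (EuclideanSpace ℝ (Fin d)) u)
      (FiberBundle.extend (EuclideanSpace ℝ (Fin d)) v) p = 0 := by
  let constField (a : EuclideanSpace ℝ (Fin d)) :
      ∀ x : EuclideanSpace ℝ (Fin d), TangentSpace 𝓘(ℝ, EuclideanSpace ℝ (Fin d)) x := fun _ ↦ a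
  have extend_eq_mpullback (w : TangentSpace I p) :
      (FiberBundle.extend (EuclideanSpace ℝ (Fin d)) w : ∀ q : M, TangentSpace I q) =ᶠ[𝓝 p]
        VectorField.mpullback I 𝓘(ℝ, EuclideanSpace ℝ (Fin d)) (extChartAt I p)
          (constField (toCoord I p p w)) := by
    filter_upwards [(chartAt H p).open_source.mem_nhds (mem_chart_source H p)] with q hq
    have inverse_toCoord : (toCoord I p q).inverse = ofCoord I p q :=
      ContinuousLinearMap.inverse_eq (ContinuousLinearMap.ext (toCoord_ofCoord hq))
        (ContinuousLinearMap.ext (ofCoord_toCoord hq))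
    rw [toCoord_eq_mfderiv hq] at inverse_toCoord
    rw [extend_eq hq, VectorField.mpullback_apply]
    exact congr($inverse_toCoord.symm (toCoord I p p w))
  have mdifferentiableAt_constField (a : EuclideanSpace ℝ (Fin d)) :
      MDiffAt (T% (constField a)) (extChartAt I p p) :=
    (contMDiffAt_vectorSpace_iff_contDiffAt (n := 1)).2 contDiffAt_const
      |>.mdifferentiableAt one_ne_zero
  have constFields_commute (a b : EuclideanSpace ℝ (Fin d)) (x : EuclideanSpace ℝ (Fin d)) :
      VectorField.mlieBracket 𝓘(ℝ, EuclideanSpace ℝ (Fin d)) (constField a) (constField b) x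
        = 0 := by
    rw [← VectorField.mlieBracketWithin_univ, VectorField.mlieBracketWithin_eq_lieBracketWithin]
    simp only [VectorField.lieBracketWithin, constField, fderivWithin_fun_const]
    exact sub_self (0 : EuclideanSpace ℝ (Fin d))
  have : IsManifold I (minSmoothness ℝ 2) M := by
    rw [minSmoothness_of_isRCLikeNormedField]
    infer_instance
  rw [(extend_eq_mpullback u).mlieBracket_vectorField_eq (extend_eq_mpullback v),
    ← VectorField.mpullback_mlieBracket (mdifferentiableAt_constField _)
      (mdifferentiableAt_constField _) (contMDiffAt_extChartAt (n := 2)) (by simp),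
    VectorField.mpullback_apply, constFields_commute, map_zero]

variable [RiemannianBundle (fun x : M ↦ TangentSpace I x)]
  [IsContMDiffRiemannianBundle I ∞ (EuclideanSpace ℝ (Fin d)) (fun x : M ↦ TangentSpace I x)]
  {p : M}

lemma tensorialAt_leviCivita_sub_coord (u : TangentSpace I p) :
    TensorialAt I (EuclideanSpace ℝ (Fin d)) (fun X : ∀ q : M, TangentSpace I q ↦
      leviCivita I X p u - ofCoord I p p (mvfderiv I (fun q ↦ toCoord I p q (X q)) p u)) p where
  smul {f X} hf hX := by
    simp only [leviCivita_smul_field hf hX, Pi.smul_apply', map_smul]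
    rw [mvfderiv_fun_smul hf (mdifferentiableAt_toCoord hX)]
    simp [ofCoord_toCoord (mem_chart_source H p), smul_sub]
  add {X Y} hX hY := by
    simp only [leviCivita_add_field hX hY, Pi.add_apply, map_add]
    rw [mvfderiv_fun_add (mdifferentiableAt_toCoord hX) (mdifferentiableAt_toCoord hY), add_apply,
      map_add]
    abel

variable (I p) in
/-- The Christoffel symbols of the chart around `p`, as a bilinear map on the tangent space at `p`:
`Γ(u, v)` is the covariant derivative along `u` of the field with constant coordinates through
`v`. -/
def christoffel : TangentSpace I p →ₗ[ℝ] TangentSpace I p →ₗ[ℝ] TangentSpace I p :=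
  LinearMap.mk₂ ℝ
    (fun u v ↦ leviCivita I (FiberBundle.extend (EuclideanSpace ℝ (Fin d)) v) p u)
    (fun _ _ _ ↦ leviCivita_add_direction (FiberBundle.mdifferentiableAt_extend ..))
    (fun _ _ _ ↦ leviCivita_smul_direction (FiberBundle.mdifferentiableAt_extend ..))
    (fun u v w ↦ by
      have := (TensorialAt.mkHom _ p (tensorialAt_leviCivita_sub_coord u)).map_add v w
      simpa only [TensorialAt.mkHom_apply_eq_extend, mvfderiv_toCoord_extend, map_zero, sub_zero]
        using this)
    (fun c u v ↦ by
      have := (TensorialAt.mkHom _ p (tensorialAt_leviCivita_sub_coord u)).map_smul c v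
      simpa only [TensorialAt.mkHom_apply_eq_extend, mvfderiv_toCoord_extend, map_zero, sub_zero]
        using this)

lemma leviCivita_extend (u v : TangentSpace I p) :
    leviCivita I (FiberBundle.extend (EuclideanSpace ℝ (Fin d)) v) p u = christoffel I p u v :=
  rfl

lemma leviCivita_eq_coord_add_christoffel {X : ∀ q : M, TangentSpace I q}
    (hX : MDiffAt (T% X) p) (u : TangentSpace I p) :
    leviCivita I X p u = ofCoord I p p (mvfderiv I (fun q ↦ toCoord I p q (X q)) p u) +
      christoffel I p u (X p) := by
  have pointwise := TensorialAt.mkHom_apply (tensorialAt_leviCivita_sub_coord u) hX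
  rw [TensorialAt.mkHom_apply_eq_extend, mvfderiv_toCoord_extend, map_zero, sub_zero,
    leviCivita_extend] at pointwise
  rw [pointwise, add_sub_cancel]

lemma christoffel_comm (u v : TangentSpace I p) : christoffel I p u v = christoffel I p v u := by
  have torsion := leviCivita_sub_leviCivita
    (FiberBundle.mdifferentiableAt_extend I (EuclideanSpace ℝ (Fin d)) u)
    (FiberBundle.mdifferentiableAt_extend I (EuclideanSpace ℝ (Fin d)) v)
  rwa [mlieBracket_extend, FiberBundle.extend_apply_self, FiberBundle.extend_apply_self,
    leviCivita_extend, leviCivita_extend, sub_eq_zero] at torsion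

lemma mvfderiv_inner_extend (u v w : TangentSpace I p) :
    mvfderiv I (fun q ↦ inner ℝ (FiberBundle.extend (EuclideanSpace ℝ (Fin d)) v q)
        (FiberBundle.extend (EuclideanSpace ℝ (Fin d)) w q)) p u =
      inner ℝ (christoffel I p u v) w + inner ℝ v (christoffel I p u w) := by
  simpa only [FiberBundle.extend_apply_self] using! mvfderiv_inner (u := u)
    (FiberBundle.mdifferentiableAt_extend I (EuclideanSpace ℝ (Fin d)) v)
    (FiberBundle.mdifferentiableAt_extend I (EuclideanSpace ℝ (Fin d)) w)

end Christoffel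

section Jacobi

variable {n : Type*} [Fintype n] [DecidableEq n]

lemma hasFDerivWithinAt_det_of_eq_one {E : Type*} [NormedAddCommGroup E] [NormedSpace ℝ E]
    {G : E → Matrix n n ℝ} {G' : n → n → E →L[ℝ] ℝ} {s : Set E} {x : E}
    (hG : ∀ i j, HasFDerivWithinAt (fun y ↦ G y i j) (G' i j) s x) (hx : G x = 1) :
    HasFDerivWithinAt (fun y ↦ (G y).det) (∑ k, G' k k) s x := by
  let detRow : ContinuousMultilinearMap ℝ (fun _ : n ↦ n → ℝ) ℝ :=
    { Matrix.detRowAlternating.toMultilinearMap with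
      cont := by
        change Continuous fun A : n → n → ℝ ↦ (Matrix.of A).det
        fun_prop }
  have hrows : HasFDerivWithinAt (fun y i j ↦ G y i j)
      (ContinuousLinearMap.pi fun i ↦ ContinuousLinearMap.pi (G' i)) s x :=
    hasFDerivWithinAt_pi.2 fun i ↦ hasFDerivWithinAt_pi.2 (hG i)
  refine ((detRow.hasFDerivAt _).comp_hasFDerivWithinAt x hrows).congr_fderiv ?_
  ext v
  simp only [ContinuousLinearMap.comp_apply, ContinuousMultilinearMap.linearDeriv_apply, sum_apply]
  refine Finset.sum_congr rfl fun k _ ↦ ?_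
  change ((G x).updateRow k fun j ↦ G' k j v).det = _
  rw [hx, ← Matrix.cramer_transpose_apply, Matrix.transpose_one, Matrix.cramer_one]
  rfl

lemma mvfderiv_congr_of_eventuallyEq {E : Type*} [NormedAddCommGroup E] [NormedSpace ℝ E]
    {H : Type*} [TopologicalSpace H] {I : ModelWithCorners ℝ E H}
    {M : Type*} [TopologicalSpace M] [ChartedSpace H M]
    {F : Type*} [NormedAddCommGroup F] [NormedSpace ℝ F] {g h : M → F} {p : M}
    (hgh : g =ᶠ[𝓝 p] h) : mvfderiv I g p = mvfderiv I h p :=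
  ContinuousLinearMap.ext fun u ↦ congr($(hgh.mfderiv_eq (I := I) (I' := 𝓘(ℝ, F))) u)

lemma mvfderiv_det_of_eq_one {E : Type*} [NormedAddCommGroup E] [NormedSpace ℝ E]
    {H : Type*} [TopologicalSpace H] {I : ModelWithCorners ℝ E H}
    {M : Type*} [TopologicalSpace M] [ChartedSpace H M] {G : M → Matrix n n ℝ} {p : M}
    (hG : ∀ i j, MDiffAt (fun q ↦ G q i j) p) (hp : G p = 1) (u : TangentSpace I p) :
    mvfderiv I (fun q ↦ (G q).det) p u = ∑ k, mvfderiv I (fun q ↦ G q k k) p u := by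
  have in_chart := hasFDerivWithinAt_det_of_eq_one (G := G ∘ (extChartAt I p).symm)
    (fun i j ↦ (hG i j).hasMFDerivAt.2) (by rw [Function.comp_apply, extChartAt_to_inv, hp])
  have hcont : ContinuousAt G p :=
    continuousAt_pi.2 fun i ↦ continuousAt_pi.2 fun j ↦ (hG i j).continuousAt
  have hdet : HasMFDerivAt I 𝓘(ℝ, ℝ) (fun q ↦ (G q).det) p _ :=
    ⟨(Continuous.matrix_det continuous_id).continuousAt.comp hcont, in_chart⟩
  rw [mvfderiv, hdet.mfderiv]
  exact sum_apply _ _ u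

end Jacobi
section VolumeDerivative

variable {d : ℕ}
  {H : Type*} [TopologicalSpace H] {I : ModelWithCorners ℝ (EuclideanSpace ℝ (Fin d)) H}
  {M : Type*} [TopologicalSpace M] [ChartedSpace H M] [IsManifold I ∞ M]
  [RiemannianBundle (fun x : M ↦ TangentSpace I x)]
  [IsContMDiffRiemannianBundle I ∞ (EuclideanSpace ℝ (Fin d)) (fun x : M ↦ TangentSpace I x)]

/- Compare `(c · coordVol)² = det ⟨E_i, E_j⟩` to first order at `p`, where `E_i` are the fields with
constant coordinates through an orthonormal basis `e_i` and `c` is the determinant of the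
coordinates of this basis. -/
lemma mvfderiv_coordVol (o : ManifoldOrientation I M) {p : M} (u : TangentSpace I p) :
    mvfderiv I (coordVol o p) p u =
      coordVol o p p * LinearMap.trace ℝ (TangentSpace I p) (christoffel I p u) := by
  have hp := mem_chart_source H p
  let e : OrthonormalBasis (Fin d) ℝ (TangentSpace I p) := stdFrame d (TangentSpace I p)
  let frame (k : Fin d) (q : M) : TangentSpace I q :=
    FiberBundle.extend (EuclideanSpace ℝ (Fin d)) (e k) q
  let gram (q : M) : Matrix (Fin d) (Fin d) ℝ := Matrix.gram ℝ fun k ↦ frame k q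
  have frame_self (k : Fin d) : frame k p = e k := FiberBundle.extend_apply_self ..
  have gram_self : gram p = 1 := by
    ext i j
    simp only [gram, Matrix.gram_apply, frame_self, orthonormal_iff_ite.1 e.orthonormal,
      Matrix.one_apply]
  let c := stdDet d fun k ↦ toCoord I p p (e k)
  have sq_eq_det : (fun _ ↦ c ^ 2) * (coordVol o p * coordVol o p) =ᶠ[𝓝 p]
      fun q ↦ (gram q).det := by
    filter_upwards [(chartAt H p).open_source.mem_nhds hp] with q hq
    have vol_frame := volumeForm_eq_coordVol_mul_stdDet o hq fun k ↦ frame k q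
    simp only [frame, toCoord_extend hq] at vol_frame
    simp only [Pi.mul_apply, gram, ← volumeForm_sq (o.or q), frame, vol_frame, c]
    ring
  have hvol : MDiffAt (coordVol o p) p := (contMDiffAt_coordVol o hp).mdifferentiableAt (by simp)
  have norm_eq_one : c ^ 2 * (coordVol o p p * coordVol o p p) = 1 := by
    refine sq_eq_det.eq_of_nhds.trans ?_
    rw [gram_self, Matrix.det_one]
  have derivative_of_det : mvfderiv I (fun q ↦ (gram q).det) p u =
      2 * LinearMap.trace ℝ (TangentSpace I p) (christoffel I p u) := by
    rw [mvfderiv_det_of_eq_one (G := gram) (fun i j ↦ mdifferentiableAt_inner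
        (FiberBundle.mdifferentiableAt_extend I (EuclideanSpace ℝ (Fin d)) (e i))
        (FiberBundle.mdifferentiableAt_extend I (EuclideanSpace ℝ (Fin d)) (e j))) gram_self,
      LinearMap.trace_eq_sum_inner _ e, Finset.mul_sum]
    refine Finset.sum_congr rfl fun k _ ↦ ?_
    refine Eq.trans ?_ (two_mul (inner ℝ (e k) (christoffel I p u (e k)))).symm
    nth_rw 1 [← real_inner_comm]
    exact mvfderiv_inner_extend u (e k) (e k)
  have derivative_of_square : c ^ 2 * (2 * coordVol o p p * mvfderiv I (coordVol o p) p u) =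
      2 * LinearMap.trace ℝ (TangentSpace I p) (christoffel I p u) := by
    rw [← derivative_of_det, ← mvfderiv_congr_of_eventuallyEq sq_eq_det,
      mvfderiv_mul mdifferentiableAt_const (hvol.mul hvol), mvfderiv_mul hvol hvol]
    simp only [mvfderiv_const, smul_zero, add_zero, smul_apply, add_apply,
      smul_eq_mul, Pi.mul_apply]
    ring
  linear_combination coordVol o p p / 2 * derivative_of_square -
    mvfderiv I (coordVol o p) p u * norm_eq_one

end VolumeDerivative

/-! ### The Piola transform -/

section PiolaAlong

variable {d : ℕ}
  {H₁ : Type*} [TopologicalSpace H₁] {I₁ : ModelWithCorners ℝ (EuclideanSpace ℝ (Fin d)) H₁}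
  {M₁ : Type*} [TopologicalSpace M₁] [ChartedSpace H₁ M₁] [IsManifold I₁ ∞ M₁]
  [RiemannianBundle (fun x : M₁ ↦ TangentSpace I₁ x)]
  {H₂ : Type*} [TopologicalSpace H₂] {I₂ : ModelWithCorners ℝ (EuclideanSpace ℝ (Fin d)) H₂}
  {M₂ : Type*} [TopologicalSpace M₂] [ChartedSpace H₂ M₂] [IsManifold I₂ ∞ M₂]
  [RiemannianBundle (fun x : M₂ ↦ TangentSpace I₂ x)]
  (o₁ : ManifoldOrientation I₁ M₁) (o₂ : ManifoldOrientation I₂ M₂)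

/-- The vector field `(Cof df)ᵀ σ` on `M₁` of a section `σ` of `f^* TM₂`. For `σ = X ∘ f` it is the
Piola transform of `X`. -/
def piolaAlong (f : M₁ → M₂) (σ : ∀ p : M₁, TangentSpace I₂ (f p)) (p : M₁) : TangentSpace I₁ p :=
  LinearMap.adjoint (cofDifferential o₁ o₂ f p) (σ p)

variable {f : M₁ → M₂}

lemma coordVol_smul_toCoord_piolaAlong (σ : ∀ p : M₁, TangentSpace I₂ (f p)) {p q : M₁} {y : M₂}
    (hq : q ∈ (chartAt H₁ p).source) (hy : f q ∈ (chartAt H₂ y).source) :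
    coordVol o₁ p q • toCoord I₁ p q (piolaAlong o₁ o₂ f σ q) =
      ∑ i, (coordVol o₂ y (f q) * stdDet d (Function.update
        (fun j ↦ toCoord I₂ y (f q) (mfderiv I₁ I₂ f q (coordVector I₁ p q j))) i
        (toCoord I₂ y (f q) (σ q)))) • EuclideanSpace.single i 1 := by
  have adjoint_Cof := volumeForm_smul_adjoint_Cof (o₁.or q) (o₂.or (f q))
    (mfderiv I₁ I₂ f q).toLinearMap (coordBasis hq) (σ q)
  rw [coe_coordBasis] at adjoint_Cof
  refine (map_smul (toCoord I₁ p q) _ _).symm.trans ((congrArg _ adjoint_Cof).trans ?_)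
  rw [map_sum]
  refine Finset.sum_congr rfl fun i _ ↦ ?_
  rw [map_smul, coordVector_eq hq, toCoord_ofCoord hq, volumeForm_eq_coordVol_mul_stdDet o₂ hy]
  congr 3
  exact funext fun j ↦ Function.apply_update (fun _ ↦ toCoord I₂ y (f q)) _ i (σ q) j

variable [IsContMDiffRiemannianBundle I₁ ∞ (EuclideanSpace ℝ (Fin d))
    (fun x : M₁ ↦ TangentSpace I₁ x)]
  [IsContMDiffRiemannianBundle I₂ ∞ (EuclideanSpace ℝ (Fin d)) (fun x : M₂ ↦ TangentSpace I₂ x)]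

lemma contMDiff_piolaAlong (hf : ContMDiff I₁ I₂ ∞ f)
    {σ : ∀ p : M₁, TangentSpace I₂ (f p)} (hσ : IsSmoothAlong I₁ I₂ f σ) :
    ContMDiff I₁ I₁.tangent ∞
      (fun p ↦ (⟨p, piolaAlong o₁ o₂ f σ p⟩ : TangentBundle I₁ M₁)) := by
  intro q
  have hq := mem_chart_source H₁ q
  have hy := mem_chart_source H₂ (f q)
  have in_coord : (fun x ↦ toCoord I₁ q x (piolaAlong o₁ o₂ f σ x)) =ᶠ[𝓝 q]
      fun x ↦ (coordVol o₁ q x)⁻¹ • ∑ i, (coordVol o₂ (f q) (f x) * stdDet d fun k ↦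
        Function.update (fun j ↦ toCoord I₂ (f q) (f x) (mfderiv I₁ I₂ f x (coordVector I₁ q x j)))
          i (toCoord I₂ (f q) (f x) (σ x)) k) • EuclideanSpace.single i 1 := by
    filter_upwards [(chartAt H₁ q).open_source.mem_nhds hq,
      hf.continuous.continuousAt.preimage_mem_nhds ((chartAt H₂ (f q)).open_source.mem_nhds hy)]
      with x hx hfx
    rw [← coordVol_smul_toCoord_piolaAlong o₁ o₂ σ hx hfx, inv_smul_smul₀ (coordVol_ne_zero o₁ hx)]
  have smooth_inv : ContMDiffAt I₁ 𝓘(ℝ, ℝ) ∞ (fun x ↦ (coordVol o₁ q x)⁻¹) q :=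
    (contDiffAt_inv ℝ (coordVol_ne_zero o₁ hq)).contMDiffAt.comp q (contMDiffAt_coordVol o₁ hq)
  refine (contMDiffAt_along_iff (b := fun q ↦ q) hq).2
    ⟨contMDiffAt_id, ContMDiffAt.congr_of_eventuallyEq ?_ in_coord⟩
  refine smooth_inv.smul (ContMDiffAt.sum fun i _ ↦ ContMDiffAt.smul
    (((contMDiffAt_coordVol o₂ hy).comp q hf.contMDiffAt).mul (contMDiffAt_stdDet fun k ↦ ?_))
    contMDiffAt_const)
  rcases eq_or_ne k i with rfl | hki
  · simpa using ((contMDiffAt_along_iff hy).1 hσ.contMDiffAt).2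
  · have smooth_df := (hf.contMDiff_tangentMap (m := ∞) (by simp)).contMDiffAt.comp q
      (contMDiffAt_coordVector hq k)
    simpa [Function.update_of_ne hki] using ((contMDiffAt_along_iff hy).1 smooth_df).2

end PiolaAlong

section PullbackConnection

variable {d : ℕ}
  {H₁ : Type*} [TopologicalSpace H₁] {I₁ : ModelWithCorners ℝ (EuclideanSpace ℝ (Fin d)) H₁}
  {M₁ : Type*} [TopologicalSpace M₁] [ChartedSpace H₁ M₁]
  {H₂ : Type*} [TopologicalSpace H₂] {I₂ : ModelWithCorners ℝ (EuclideanSpace ℝ (Fin d)) H₂}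
  {M₂ : Type*} [TopologicalSpace M₂] [ChartedSpace H₂ M₂] [IsManifold I₂ ∞ M₂]
  [RiemannianBundle (fun x : M₂ ↦ TangentSpace I₂ x)]
  [IsContMDiffRiemannianBundle I₂ ∞ (EuclideanSpace ℝ (Fin d)) (fun x : M₂ ↦ TangentSpace I₂ x)]
  {f : M₁ → M₂}

/-- The covariant derivative `u ↦ ∇_u σ` at `q` of a section `σ` of `f^* TM₂`, as a linear map. -/
def covDerivAlong (f : M₁ → M₂) (σ : ∀ p : M₁, TangentSpace I₂ (f p)) (q : M₁) :
    TangentSpace I₁ q →ₗ[ℝ] TangentSpace I₂ (f q) :=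
  (ofCoord I₂ (f q) (f q)).toLinearMap ∘ₗ
      (mvfderiv I₁ (fun x ↦ toCoord I₂ (f q) (f x) (σ x)) q).toLinearMap +
    (christoffel I₂ (f q)).flip (σ q) ∘ₗ (mfderiv I₁ I₂ f q).toLinearMap

lemma covDerivAlong_apply (σ : ∀ p : M₁, TangentSpace I₂ (f p)) {q : M₁} (u : TangentSpace I₁ q) :
    covDerivAlong f σ q u =
      ofCoord I₂ (f q) (f q) (mvfderiv I₁ (fun x ↦ toCoord I₂ (f q) (f x) (σ x)) q u) +
        christoffel I₂ (f q) (mfderiv I₁ I₂ f q u) (σ q) :=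
  rfl

lemma pullbackConnection_eq_covDerivAlong [IsManifold I₁ 1 M₁]
    [RiemannianBundle (fun x : M₁ ↦ TangentSpace I₁ x)] {q : M₁} (hf : ContinuousAt f q)
    (σ : ∀ p : M₁, TangentSpace I₂ (f p)) (u : TangentSpace I₁ q) :
    pullbackConnection I₁ I₂ f σ q u = covDerivAlong f σ q u := by
  have hy := mem_chart_source H₂ (f q)
  have in_trivialization : (fun x ↦ toCoord I₂ (f q) (f x) (σ x)) =ᶠ[𝓝 q] fun x ↦
      (trivializationAt (EuclideanSpace ℝ (Fin d)) (TangentSpace I₂ (M := M₂)) (f q)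
        ⟨f x, σ x⟩).2 := by
    filter_upwards [hf.preimage_mem_nhds ((chartAt H₂ (f q)).open_source.mem_nhds hy)] with x hx
    exact toCoord_apply hx _
  rw [covDerivAlong_apply, mvfderiv_congr_of_eventuallyEq in_trivialization, ofCoord_apply hy]
  rfl

end PullbackConnection

section ConnectionInnerCof

variable {d : ℕ}
  {H₁ : Type*} [TopologicalSpace H₁] {I₁ : ModelWithCorners ℝ (EuclideanSpace ℝ (Fin d)) H₁}
  {M₁ : Type*} [TopologicalSpace M₁] [ChartedSpace H₁ M₁] [IsManifold I₁ ∞ M₁]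
  [RiemannianBundle (fun x : M₁ ↦ TangentSpace I₁ x)]
  {H₂ : Type*} [TopologicalSpace H₂] {I₂ : ModelWithCorners ℝ (EuclideanSpace ℝ (Fin d)) H₂}
  {M₂ : Type*} [TopologicalSpace M₂] [ChartedSpace H₂ M₂] [IsManifold I₂ ∞ M₂]
  [RiemannianBundle (fun x : M₂ ↦ TangentSpace I₂ x)]
  (o₁ : ManifoldOrientation I₁ M₁) (o₂ : ManifoldOrientation I₂ M₂)

/-- The inner product `⟨∇σ, Cof df⟩` of `f^* TM₂`-valued one-forms. -/
def connectionInnerCof (f : M₁ → M₂) (σ : ∀ p : M₁, TangentSpace I₂ (f p)) (p : M₁) : ℝ :=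
  ∑ i, inner ℝ
    (pullbackConnection I₁ I₂ f σ p (stdOrthonormalBasis ℝ (TangentSpace I₁ p) i))
    (cofDifferential o₁ o₂ f p (stdOrthonormalBasis ℝ (TangentSpace I₁ p) i))

variable [IsContMDiffRiemannianBundle I₂ ∞ (EuclideanSpace ℝ (Fin d))
    (fun x : M₂ ↦ TangentSpace I₂ x)]
  {f : M₁ → M₂} {p q : M₁}

lemma connectionInnerCof_eq_trace (hf : ContinuousAt f q) (σ : ∀ p : M₁, TangentSpace I₂ (f p)) :
    connectionInnerCof o₁ o₂ f σ q = LinearMap.trace ℝ (TangentSpace I₁ q)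
      (LinearMap.adjoint (cofDifferential o₁ o₂ f q) ∘ₗ covDerivAlong f σ q) := by
  simp only [connectionInnerCof, pullbackConnection_eq_covDerivAlong hf,
    sum_inner_stdOrthonormalBasis]

/- By the symmetry of the Christoffel symbols, their contribution to `⟨∇σ, Cof df⟩` is
`tr Γ(σ, ·)` times a determinant, i.e. a logarithmic derivative of the volume of `M₂` along `σ`. -/
lemma coordVol_mul_connectionInnerCof_eq_add (hf : ContinuousAt f q)
    (σ : ∀ p : M₁, TangentSpace I₂ (f p)) (hq : q ∈ (chartAt H₁ p).source) :
    coordVol o₁ p q * connectionInnerCof o₁ o₂ f σ q =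
      coordVol o₂ (f q) (f q) * ∑ i, stdDet d (Function.update
        (fun j ↦ toCoord I₂ (f q) (f q) (mfderiv I₁ I₂ f q (coordVector I₁ p q j))) i
        (mvfderiv I₁ (fun x ↦ toCoord I₂ (f q) (f x) (σ x)) q (coordVector I₁ p q i))) +
      (stdDet d fun j ↦ toCoord I₂ (f q) (f q) (mfderiv I₁ I₂ f q (coordVector I₁ p q j))) *
        mvfderiv I₂ (coordVol o₂ (f q)) (f q) (σ q) := by
  have hy := mem_chart_source H₂ (f q)
  let Γ := christoffel I₂ (f q) (σ q)
  let A := (mfderiv I₁ I₂ f q).toLinearMap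
  have christoffel_part : ∑ i, (o₂.or (f q)).volumeForm (Function.update
        (A ∘ coordVector I₁ p q) i (Γ (A (coordVector I₁ p q i)))) =
      (stdDet d fun j ↦ toCoord I₂ (f q) (f q) (A (coordVector I₁ p q j))) *
        mvfderiv I₂ (coordVol o₂ (f q)) (f q) (σ q) := by
    rw [mvfderiv_coordVol, mul_left_comm, ← mul_assoc, ← volumeForm_eq_coordVol_mul_stdDet o₂ hy]
    exact sum_alternatingMap_update_map _ (coordBasis hy) Γ (A ∘ coordVector I₁ p q)
  have derivative_part (i : Fin d) (v : EuclideanSpace ℝ (Fin d)) :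
      (o₂.or (f q)).volumeForm (Function.update (A ∘ coordVector I₁ p q) i
          (ofCoord I₂ (f q) (f q) v)) =
        coordVol o₂ (f q) (f q) * stdDet d (Function.update
          (fun j ↦ toCoord I₂ (f q) (f q) (A (coordVector I₁ p q j))) i v) := by
    rw [volumeForm_eq_coordVol_mul_stdDet o₂ hy]
    congr 2
    refine (funext fun j ↦ Function.apply_update (fun _ ↦ toCoord I₂ (f q) (f q)) _ i _ j).trans ?_
    rw [toCoord_ofCoord hy]
    rfl
  rw [connectionInnerCof_eq_trace o₁ o₂ hf, coordVol, ← coe_coordBasis hq]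
  refine (volumeForm_mul_trace_adjoint_Cof_comp (o₁.or q) (o₂.or (f q)) A (covDerivAlong f σ q)
    (coordBasis hq)).trans ?_
  simp only [coe_coordBasis, covDerivAlong_apply, AlternatingMap.map_update_add,
    Finset.sum_add_distrib, christoffel_comm _ (σ q)]
  refine congrArg₂ _ ?_ christoffel_part
  rw [Finset.mul_sum]
  exact Finset.sum_congr rfl fun i _ ↦ derivative_part i _

end ConnectionInnerCof

section CoordinateFlux

variable {d : ℕ}
  {H : Type*} [TopologicalSpace H] {I : ModelWithCorners ℝ (EuclideanSpace ℝ (Fin d)) H}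
  {M : Type*} [TopologicalSpace M] [ChartedSpace H M] [IsManifold I ∞ M]
  [RiemannianBundle (fun x : M ↦ TangentSpace I x)]

/-- The `i`-th component of a vector field in the chart around `p`, multiplied by the volume of the
coordinate frame: the flux whose coordinate divergence is the divergence times that volume. -/
def coordFlux (o : ManifoldOrientation I M) (p : M) (Z : ∀ q : M, TangentSpace I q) (i : Fin d)
    (q : M) : ℝ :=
  coordVol o p q * toCoord I p q (Z q) i

variable [IsContMDiffRiemannianBundle I ∞ (EuclideanSpace ℝ (Fin d))
    (fun x : M ↦ TangentSpace I x)]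

lemma contMDiffAt_coordFlux (o : ManifoldOrientation I M) {p q : M}
    {Z : ∀ q : M, TangentSpace I q} (hZ : ContMDiffAt I I.tangent ∞ (T% Z) q)
    (hq : q ∈ (chartAt H p).source) (i : Fin d) :
    ContMDiffAt I 𝓘(ℝ, ℝ) ∞ (coordFlux o p Z i) q :=
  (contMDiffAt_coordVol o hq).mul <|
    (EuclideanSpace.proj i : EuclideanSpace ℝ (Fin d) →L[ℝ] ℝ).contDiff.contMDiff.contMDiffAt.comp q
      ((contMDiffAt_along_iff (b := fun q ↦ q) hq).1 hZ).2

end CoordinateFlux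

section ChartExpression

variable {d : ℕ}
  {H₁ : Type*} [TopologicalSpace H₁] {I₁ : ModelWithCorners ℝ (EuclideanSpace ℝ (Fin d)) H₁}
  {M₁ : Type*} [TopologicalSpace M₁] [ChartedSpace H₁ M₁] [IsManifold I₁ ∞ M₁]
  [RiemannianBundle (fun x : M₁ ↦ TangentSpace I₁ x)]
  {H₂ : Type*} [TopologicalSpace H₂] {I₂ : ModelWithCorners ℝ (EuclideanSpace ℝ (Fin d)) H₂}
  {M₂ : Type*} [TopologicalSpace M₂] [ChartedSpace H₂ M₂] [IsManifold I₂ ∞ M₂]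
  [RiemannianBundle (fun x : M₂ ↦ TangentSpace I₂ x)]
  (o₁ : ManifoldOrientation I₁ M₁) (o₂ : ManifoldOrientation I₂ M₂)
  {f : M₁ → M₂} {p q : M₁}

lemma coordFlux_piolaAlong {y : M₂} (hf : MDifferentiableAt I₁ I₂ f q)
    (σ : ∀ p : M₁, TangentSpace I₂ (f p)) (hq : q ∈ (chartAt H₁ p).source)
    (hy : f q ∈ (chartAt H₂ y).source) (i : Fin d) :
    coordFlux o₁ p (piolaAlong o₁ o₂ f σ) i q =
      coordVol o₂ y (f q) * stdDet d (Function.update (fun j ↦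
        fderivWithin ℝ (extChartAt I₂ y ∘ f ∘ (extChartAt I₁ p).symm) (range I₁) (extChartAt I₁ p q)
          (EuclideanSpace.single j 1)) i (toCoord I₂ y (f q) (σ q))) := by
  have component := congr($(coordVol_smul_toCoord_piolaAlong o₁ o₂ σ hq hy) i)
  simp only [coordVector_eq hq, toCoord_mfderiv_ofCoord hq hy hf] at component
  simpa [coordFlux, Finset.sum_apply, Pi.single_apply] using component

lemma coordFlux_piolaAlong_comp_extChartAt_symm {y : M₂} (hf : MDifferentiable I₁ I₂ f)
    (σ : ∀ p : M₁, TangentSpace I₂ (f p)) (hq : q ∈ (chartAt H₁ p).source)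
    (hy : f q ∈ (chartAt H₂ y).source) (i : Fin d) :
    coordFlux o₁ p (piolaAlong o₁ o₂ f σ) i ∘ (extChartAt I₁ p).symm
      =ᶠ[𝓝[range I₁] extChartAt I₁ p q]
    fun x ↦ (coordVol o₂ y ∘ (extChartAt I₂ y).symm)
        ((extChartAt I₂ y ∘ f ∘ (extChartAt I₁ p).symm) x) *
      stdDet d (Function.update (fun j ↦
        fderivWithin ℝ (extChartAt I₂ y ∘ f ∘ (extChartAt I₁ p).symm) (range I₁) x
          (EuclideanSpace.single j 1)) i
        (((fun z ↦ toCoord I₂ y (f z) (σ z)) ∘ (extChartAt I₁ p).symm) x)) := by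
  have hq' : q ∈ (extChartAt I₁ p).source := by rwa [extChartAt_source]
  have image_in_chart : ∀ᶠ x in 𝓝 (extChartAt I₁ p q),
      f ((extChartAt I₁ p).symm x) ∈ (chartAt H₂ y).source :=
    (hf.continuous.continuousAt.comp (continuousAt_extChartAt_symm' hq')).preimage_mem_nhds <| by
      simpa only [Function.comp_apply, extChartAt_symm_apply hq] using
        (chartAt H₂ y).open_source.mem_nhds hy
  filter_upwards [extChartAt_target_mem_nhdsWithin' hq', nhdsWithin_le_nhds image_in_chart]
    with x hx hfx
  simp only [Function.comp_apply, coordFlux_piolaAlong o₁ o₂ (hf _) σ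
    (extChartAt_symm_mem_source hx) hfx, (extChartAt I₁ p).right_inv hx,
    extChartAt_symm_apply hfx]

variable [IsContMDiffRiemannianBundle I₁ ∞ (EuclideanSpace ℝ (Fin d))
    (fun x : M₁ ↦ TangentSpace I₁ x)]
  [IsContMDiffRiemannianBundle I₂ ∞ (EuclideanSpace ℝ (Fin d)) (fun x : M₂ ↦ TangentSpace I₂ x)]

lemma sum_mvfderiv_coordFlux_piolaAlong (hf : ContMDiff I₁ I₂ ∞ f)
    {σ : ∀ p : M₁, TangentSpace I₂ (f p)} (hσ : IsSmoothAlong I₁ I₂ f σ)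
    (hq : q ∈ (chartAt H₁ p).source) :
    ∑ i, mvfderiv I₁ (coordFlux o₁ p (piolaAlong o₁ o₂ f σ) i) q (coordVector I₁ p q i) =
      coordVol o₂ (f q) (f q) * ∑ i, stdDet d (Function.update
        (fun j ↦ toCoord I₂ (f q) (f q) (mfderiv I₁ I₂ f q (coordVector I₁ p q j))) i
        (mvfderiv I₁ (fun x ↦ toCoord I₂ (f q) (f x) (σ x)) q (coordVector I₁ p q i))) +
      (stdDet d fun j ↦ toCoord I₂ (f q) (f q) (mfderiv I₁ I₂ f q (coordVector I₁ p q j))) *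
        mvfderiv I₂ (coordVol o₂ (f q)) (f q) (σ q) := by
  have hy := mem_chart_source H₂ (f q)
  have hmf : MDifferentiable I₁ I₂ f := hf.mdifferentiable (by simp)
  have hσ_coord := ((contMDiffAt_along_iff hy).1 hσ.contMDiffAt).2
  have hvol := contMDiffAt_coordVol o₂ hy
  have hflux := contMDiffAt_coordFlux o₁ (contMDiff_piolaAlong o₁ o₂ hf hσ).contMDiffAt hq
  let x₀ := extChartAt I₁ p q
  let φ := extChartAt I₂ (f q) ∘ f ∘ (extChartAt I₁ p).symm
  let s := (fun x ↦ toCoord I₂ (f q) (f x) (σ x)) ∘ (extChartAt I₁ p).symm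
  let w := coordVol o₂ (f q) ∘ (extChartAt I₂ (f q)).symm
  have hx₀ : x₀ ∈ range I₁ := extChartAt_mem_range
  have hφ_x₀ : φ x₀ = extChartAt I₂ (f q) (f q) :=
    congrArg (fun z ↦ extChartAt I₂ (f q) (f z)) (extChartAt_symm_apply hq)
  have hs_x₀ : s x₀ = toCoord I₂ (f q) (f q) (σ q) :=
    congrArg (fun z ↦ toCoord I₂ (f q) (f z) (σ z)) (extChartAt_symm_apply hq)
  have hw_x₀ : w (φ x₀) = coordVol o₂ (f q) (f q) :=
    (congrArg w hφ_x₀).trans (congrArg (coordVol o₂ (f q)) (extChartAt_symm_apply hy))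
  have flat_identity := sum_fderivWithin_weighted_alternatingMap_update
    (EuclideanSpace.basisFun (Fin d) ℝ).toBasis (stdDet d)
    (fun i : Fin d ↦ EuclideanSpace.single i (1 : ℝ)) (φ := φ) (σ := s) (w := w) (t := range I₂)
    I₁.uniqueDiffOn (I₁.range_subset_closure_interior hx₀) hx₀
    ((contDiffWithinAt_comp_extChartAt_symm hq
      ((contMDiffAt_extChartAt' hy).comp q hf.contMDiffAt)).of_le ENat.LEInfty.out)
    ((contDiffWithinAt_comp_extChartAt_symm hq hσ_coord).differentiableWithinAt (by simp))
    (fun _ _ ↦ extChartAt_mem_range)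
    (hφ_x₀ ▸ (contDiffWithinAt_comp_extChartAt_symm hy hvol).differentiableWithinAt (by simp))
  rw [← ofCoord_toCoord hy (σ q)]
  simp only [coordVector_eq hq, toCoord_mfderiv_ofCoord hq hy (hmf q),
    mvfderiv_ofCoord hq (hσ_coord.mdifferentiableAt (by simp)),
    mvfderiv_ofCoord hq ((hflux _).mdifferentiableAt (by simp)),
    mvfderiv_ofCoord hy (hvol.mdifferentiableAt (by simp)),
    (coordFlux_piolaAlong_comp_extChartAt_symm o₁ o₂ hmf σ hq hy _).fderivWithin_eq_of_mem hx₀]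
  rw [← hw_x₀, ← hφ_x₀, ← hs_x₀]
  exact flat_identity

lemma coordVol_mul_connectionInnerCof (hf : ContMDiff I₁ I₂ ∞ f)
    {σ : ∀ p : M₁, TangentSpace I₂ (f p)} (hσ : IsSmoothAlong I₁ I₂ f σ)
    (hq : q ∈ (chartAt H₁ p).source) :
    coordVol o₁ p q * connectionInnerCof o₁ o₂ f σ q =
      ∑ i, mvfderiv I₁ (coordFlux o₁ p (piolaAlong o₁ o₂ f σ) i) q (coordVector I₁ p q i) :=
  (coordVol_mul_connectionInnerCof_eq_add o₁ o₂ hf.continuous.continuousAt σ hq).trans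
    (sum_mvfderiv_coordFlux_piolaAlong o₁ o₂ hf hσ hq).symm

end ChartExpression

section Divergence

variable {d : ℕ}
  {H : Type*} [TopologicalSpace H] {I : ModelWithCorners ℝ (EuclideanSpace ℝ (Fin d)) H}
  {M : Type*} [TopologicalSpace M] [ChartedSpace H M] [IsManifold I ∞ M]
  [RiemannianBundle (fun x : M ↦ TangentSpace I x)]
  (o : ManifoldOrientation I M)

lemma piolaAlong_id (Z : ∀ q : M, TangentSpace I q) : piolaAlong o o id Z = Z := by
  funext q
  rw [piolaAlong, cofDifferential, mfderiv_id]
  exact adjoint_Cof_id (o.or q) (Z q)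

variable [IsContMDiffRiemannianBundle I ∞ (EuclideanSpace ℝ (Fin d))
    (fun x : M ↦ TangentSpace I x)]
  {X : ∀ q : M, TangentSpace I q} {p q : M}

lemma covDerivAlong_id_apply (hX : MDiffAt (T% X) q) (u : TangentSpace I q) :
    covDerivAlong (id : M → M) X q u = leviCivita I X q u := by
  rw [leviCivita_eq_coord_add_christoffel hX, covDerivAlong_apply, mfderiv_id]
  rfl

lemma trace_covDerivAlong_id (hX : MDiffAt (T% X) q) :
    LinearMap.trace ℝ (TangentSpace I q) (covDerivAlong (id : M → M) X q) = divergence I X q := by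
  simp only [divergence, LinearMap.trace_eq_sum_inner _ (stdOrthonormalBasis ℝ (TangentSpace I q)),
    ← covDerivAlong_id_apply hX, real_inner_comm]

lemma connectionInnerCof_id (hX : MDiffAt (T% X) q) :
    connectionInnerCof o o id X q = divergence I X q := by
  have adjoint_cof : LinearMap.adjoint (cofDifferential o o id q) = LinearMap.id :=
    LinearMap.ext fun v ↦ by
      rw [cofDifferential, mfderiv_id]
      exact adjoint_Cof_id (o.or q) v
  rw [connectionInnerCof_eq_trace o o continuousAt_id, adjoint_cof, LinearMap.id_comp]
  exact trace_covDerivAlong_id hX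

lemma coordVol_mul_divergence (hX : ContMDiff I I.tangent ∞ (T% X))
    (hq : q ∈ (chartAt H p).source) :
    coordVol o p q * divergence I X q =
      ∑ i, mvfderiv I (coordFlux o p X i) q (coordVector I p q i) := by
  rw [← connectionInnerCof_id o (hX.contMDiffAt.mdifferentiableAt (by simp)),
    coordVol_mul_connectionInnerCof o o contMDiff_id hX hq, piolaAlong_id]

end Divergence

section PiolaIdentity

variable {d : ℕ}
  {H₁ : Type*} [TopologicalSpace H₁] {I₁ : ModelWithCorners ℝ (EuclideanSpace ℝ (Fin d)) H₁}
  {M₁ : Type*} [TopologicalSpace M₁] [ChartedSpace H₁ M₁]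
  {H₂ : Type*} [TopologicalSpace H₂] {I₂ : ModelWithCorners ℝ (EuclideanSpace ℝ (Fin d)) H₂}
  {M₂ : Type*} [TopologicalSpace M₂] [ChartedSpace H₂ M₂] [IsManifold I₂ ∞ M₂]
  [RiemannianBundle (fun x : M₂ ↦ TangentSpace I₂ x)]
  [IsContMDiffRiemannianBundle I₂ ∞ (EuclideanSpace ℝ (Fin d)) (fun x : M₂ ↦ TangentSpace I₂ x)]
  {f : M₁ → M₂} {X : ∀ y : M₂, TangentSpace I₂ y} {q : M₁}

lemma covDerivAlong_comp (hf : MDifferentiableAt I₁ I₂ f q)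
    (hX : ContMDiffAt I₂ I₂.tangent ∞ (T% X) (f q)) :
    covDerivAlong f (fun p ↦ X (f p)) q =
      covDerivAlong (id : M₂ → M₂) X (f q) ∘ₗ (mfderiv I₁ I₂ f q).toLinearMap := by
  have hX_coord : MDifferentiableAt I₂ 𝓘(ℝ, EuclideanSpace ℝ (Fin d))
      (fun y ↦ toCoord I₂ (f q) y (X y)) (f q) :=
    ((contMDiffAt_along_iff (b := fun y ↦ y)
      (mem_chart_source H₂ (f q))).1 hX).2.mdifferentiableAt (by simp)
  refine LinearMap.ext fun u ↦ ?_
  rw [LinearMap.comp_apply, covDerivAlong_apply, covDerivAlong_apply, mfderiv_id]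
  congr 2
  exact congr($(mfderiv_comp (I'' := 𝓘(ℝ, EuclideanSpace ℝ (Fin d))) q hX_coord hf) u)

variable [IsManifold I₁ ∞ M₁] [RiemannianBundle (fun x : M₁ ↦ TangentSpace I₁ x)]
  (o₁ : ManifoldOrientation I₁ M₁) (o₂ : ManifoldOrientation I₂ M₂)

lemma connectionInnerCof_comp (hf : MDifferentiableAt I₁ I₂ f q)
    (hX : ContMDiffAt I₂ I₂.tangent ∞ (T% X) (f q)) :
    connectionInnerCof o₁ o₂ f (fun p ↦ X (f p)) q =
      divergence I₂ X (f q) * detDifferential o₁ o₂ f q := by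
  have differential_comp_adjoint :
      (mfderiv I₁ I₂ f q).toLinearMap ∘ₗ LinearMap.adjoint (cofDifferential o₁ o₂ f q) =
        detDifferential o₁ o₂ f q • LinearMap.id :=
    LinearMap.ext fun w ↦
      comp_adjoint_Cof (o₁.or q) (o₂.or (f q)) (mfderiv I₁ I₂ f q).toLinearMap w
  rw [connectionInnerCof_eq_trace o₁ o₂ hf.continuousAt, covDerivAlong_comp hf hX,
    LinearMap.trace_comp_comm', LinearMap.comp_assoc, differential_comp_adjoint,
    LinearMap.comp_smul, LinearMap.comp_id, map_smul, smul_eq_mul, mul_comm]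
  exact congrArg (· * _) (trace_covDerivAlong_id (hX.mdifferentiableAt (by simp)))

variable [IsContMDiffRiemannianBundle I₁ ∞ (EuclideanSpace ℝ (Fin d))
    (fun x : M₁ ↦ TangentSpace I₁ x)]

theorem divergence_piolaAlong (hf : ContMDiff I₁ I₂ ∞ f) {σ : ∀ p : M₁, TangentSpace I₂ (f p)}
    (hσ : IsSmoothAlong I₁ I₂ f σ) (p : M₁) :
    divergence I₁ (piolaAlong o₁ o₂ f σ) p = connectionInnerCof o₁ o₂ f σ p := by
  have hp := mem_chart_source H₁ p
  refine mul_left_cancel₀ (coordVol_ne_zero o₁ hp) ?_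
  rw [coordVol_mul_divergence o₁ (contMDiff_piolaAlong o₁ o₂ hf hσ) hp,
    coordVol_mul_connectionInnerCof o₁ o₂ hf hσ hp]

theorem divergence_piola (hf : ContMDiff I₁ I₂ ∞ f) (hX : ContMDiff I₂ I₂.tangent ∞ (T% X))
    (p : M₁) :
    divergence I₁ (piola o₁ o₂ f X) p = divergence I₂ X (f p) * detDifferential o₁ o₂ f p :=
  (divergence_piolaAlong o₁ o₂ hf (hX.comp hf) p).trans
    (connectionInnerCof_comp o₁ o₂ (hf.mdifferentiable (by simp) p) hX.contMDiffAt)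

end PiolaIdentity

/-! ### The Riemannian volume -/

section VolumeMeasure

lemma restrict_iSup_eq_of_restrict_inter_eq {X ι : Type*} [MeasurableSpace X] {μ : ι → Measure X}
    {U : ι → Set X} (hU : ∀ i, MeasurableSet (U i)) (hμ : ∀ i, (μ i).restrict (U i) = μ i)
    (hoverlap : ∀ i j, (μ i).restrict (U i ∩ U j) = (μ j).restrict (U i ∩ U j))
    {e : ℕ → ι} (hcover : ⋃ n, U (e n) = univ) (i : ι) : (⨆ j, μ j).restrict (U i) = μ i := by
  let D := disjointed (U ∘ e)
  have hD (n : ℕ) : MeasurableSet (D n) := MeasurableSet.disjointed (fun n ↦ hU (e n)) n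
  have hDU (n : ℕ) : D n ⊆ U (e n) := disjointed_subset (U ∘ e) n
  let ν := Measure.sum fun n ↦ (μ (e n)).restrict (D n)
  have restrict_piece (j : ι) (n : ℕ) :
      ((μ (e n)).restrict (D n)).restrict (U j) = (μ j).restrict (D n) := by
    have subset_overlap : U j ∩ D n ⊆ U (e n) ∩ U j := fun x hx ↦ ⟨hDU n hx.2, hx.1⟩
    rw [Measure.restrict_restrict (hU j), ← Measure.restrict_restrict_of_subset subset_overlap,
      hoverlap, Measure.restrict_restrict_of_subset subset_overlap, inter_comm,
      ← Measure.restrict_restrict (hD n), hμ]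
  have hν (j : ι) : ν.restrict (U j) = μ j := by
    rw [Measure.restrict_sum _ (hU j)]
    simp only [restrict_piece]
    rw [← Measure.restrict_iUnion (disjoint_disjointed _) hD, iUnion_disjointed]
    exact (congrArg _ hcover).trans Measure.restrict_univ
  have iSup_le_ν : ⨆ j, μ j ≤ ν := iSup_le fun j ↦ (hν j).symm.trans_le Measure.restrict_le_self
  refine le_antisymm ((Measure.restrict_mono_measure iSup_le_ν _).trans_eq (hν i)) ?_
  exact (hμ i).symm.trans_le (Measure.restrict_mono_measure (le_iSup μ i) _)

end VolumeMeasure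

section ChartVolume

variable {d : ℕ}
  {H : Type*} [TopologicalSpace H] {I : ModelWithCorners ℝ (EuclideanSpace ℝ (Fin d)) H}
  {M : Type*} [TopologicalSpace M] [ChartedSpace H M]

lemma measurableSet_extChartAt_target (p : M) : MeasurableSet (extChartAt I p).target := by
  rw [extChartAt_target]
  exact ((chartAt H p).open_target.preimage I.continuous_symm).measurableSet.inter
    I.isClosed_range.measurableSet

lemma measurableSet_extChartAt_image [MeasurableSpace M] [BorelSpace M] {p : M} {A : Set M}
    (hA : MeasurableSet A) (hAp : A ⊆ (chartAt H p).source) :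
    MeasurableSet (extChartAt I p '' A) := by
  rw [← extChartAt_source I] at hAp
  have preimage_measurable : MeasurableSet ((extChartAt I p).target.domRestrict
      (extChartAt I p).symm ⁻¹' A) :=
    (continuousOn_iff_continuous_domRestrict.1 (continuousOn_extChartAt_symm p)).measurable hA
  rw [(extChartAt I p).image_eq_target_inter_inv_preimage hAp, ← Subtype.image_preimage_coe]
  exact (measurableSet_extChartAt_target p).subtype_image preimage_measurable

lemma extChartAt_image_subset_target {p : M} {A : Set M} (hAp : A ⊆ (chartAt H p).source) :
    extChartAt I p '' A ⊆ (extChartAt I p).target := by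
  rw [← extChartAt_source I] at hAp
  exact (image_mono hAp).trans (extChartAt I p).image_source_eq_target.subset

lemma image_extChartAt_comp_symm {p : M} (q : M) {A : Set M} (hAp : A ⊆ (chartAt H p).source) :
    (extChartAt I q ∘ (extChartAt I p).symm) '' (extChartAt I p '' A) = extChartAt I q '' A := by
  rw [image_comp, (extChartAt I p).symm_image_image_of_subset_source
    (hAp.trans_eq (extChartAt_source I p).symm)]

lemma injOn_extChartAt_comp_symm {p q : M} {A : Set M} (hAp : A ⊆ (chartAt H p).source)
    (hAq : A ⊆ (chartAt H q).source) :
    InjOn (extChartAt I q ∘ (extChartAt I p).symm) (extChartAt I p '' A) := by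
  rw [← extChartAt_source I] at hAq
  refine ((extChartAt I q).injOn.mono hAq).comp
    ((extChartAt I p).symm.injOn.mono (extChartAt_image_subset_target hAp)) ?_
  rintro _ ⟨z, hz, rfl⟩
  rwa [extChartAt_symm_apply (hAp hz)]

lemma volume_extChartAt_image_ne_zero {p : M} {A : Set M} (hA : A ∈ 𝓝 p) :
    volume (extChartAt I p '' A) ≠ 0 := by
  obtain ⟨V, hV, hpV, hVA⟩ := mem_nhdsWithin.1
    (map_extChartAt_nhds (I := I) p ▸ image_mem_map hA)
  have interior_nonempty : (V ∩ interior (range I)).Nonempty :=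
    mem_closure_iff.1 (I.range_subset_closure_interior extChartAt_mem_range) V hV hpV
  refine ((hV.inter isOpen_interior).measure_pos volume interior_nonempty).ne' ∘ fun h ↦ ?_
  exact measure_mono_null (fun x hx ↦ hVA ⟨hx.1, interior_subset hx.2⟩) h

lemma hasFDerivWithinAt_extChartAt_comp_symm [IsManifold I ∞ M] {p q z : M}
    (hp : z ∈ (chartAt H p).source) (hq : z ∈ (chartAt H q).source) :
    HasFDerivWithinAt (extChartAt I q ∘ (extChartAt I p).symm) (toCoord I q z ∘L ofCoord I p z)
      (range I) (extChartAt I p z) := by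
  have transition_differentiable : DifferentiableWithinAt ℝ
      (extChartAt I q ∘ (extChartAt I p).symm) (range I) (extChartAt I p z) :=
    (contDiffWithinAt_comp_extChartAt_symm hp (contMDiffAt_extChartAt' hq)
      ).differentiableWithinAt (n := ∞) (by simp)
  convert transition_differentiable.hasFDerivWithinAt
  ext1 v
  have := toCoord_mfderiv_ofCoord (I₁ := I) (I₂ := I) (f := id) hp hq mdifferentiableAt_id v
  rwa [mfderiv_id] at this

variable [IsManifold I ∞ M] [RiemannianBundle (fun x : M ↦ TangentSpace I x)]

lemma gramDet_eq_det_sq_mul {p q z : M} (hp : z ∈ (chartAt H p).source)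
    (hq : z ∈ (chartAt H q).source) :
    gramDet I p z = (toCoord I q z ∘L ofCoord I p z).det ^ 2 * gramDet I q z := by
  let o : Orientation ℝ (TangentSpace I z) (Fin d) := (coordBasis hp).orientation
  have det_transition : (coordBasis hq).det (coordVector I p z) =
      (toCoord I q z ∘L ofCoord I p z).det := by
    rw [ContinuousLinearMap.det, ← LinearMap.det_toMatrix
      (EuclideanSpace.basisFun (Fin d) ℝ).toBasis, Module.Basis.det_apply]
    congr 1
    ext i j
    rw [Module.Basis.toMatrix_apply, coordBasis_repr, coordVector_eq hp]
    simp [LinearMap.toMatrix_apply]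
  have volume_change := alternatingMap_apply_eq_det_mul o.volumeForm (coordBasis hq)
    (coordVector I p z)
  rw [coe_coordBasis, det_transition] at volume_change
  rw [gramDet, gramDet, ← volumeForm_sq o, ← volumeForm_sq o, volume_change, mul_pow]

lemma continuousOn_sqrt_gramDet
    [IsContMDiffRiemannianBundle I ∞ (EuclideanSpace ℝ (Fin d)) (fun x : M ↦ TangentSpace I x)]
    (p : M) :
    ContinuousOn (fun y ↦ √(gramDet I p ((extChartAt I p).symm y))) (extChartAt I p).target :=
  fun y hy ↦ (contMDiffAt_gramDet (extChartAt_symm_mem_source hy)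
    ).continuousAt.sqrt.comp_continuousWithinAt (continuousOn_extChartAt_symm p y hy)


variable [MeasurableSpace M]

lemma chartVolume_eq_map (p : M) : chartVolume I p = Measure.map (extChartAt I p).symm
    ((volume.withDensity fun y ↦ ENNReal.ofReal (√(gramDet I p ((extChartAt I p).symm y)))).restrict
      (extChartAt I p).target) :=
  rfl

variable [BorelSpace M]

lemma chartVolume_apply {p : M} {A : Set M} (hA : MeasurableSet A)
    (hAp : A ⊆ (chartAt H p).source) :
    chartVolume I p A = ∫⁻ y in extChartAt I p '' A,
      ENNReal.ofReal (√(gramDet I p ((extChartAt I p).symm y))) := by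
  have hT := measurableSet_extChartAt_target (I := I) p
  rw [chartVolume_eq_map, Measure.map_apply_of_aemeasurable
    ((continuousOn_extChartAt_symm p).aemeasurable hT) hA]
  have image_eq := (extChartAt I p).image_eq_target_inter_inv_preimage
    (hAp.trans_eq (extChartAt_source I p).symm)
  rw [Measure.restrict_apply' hT, inter_comm, ← image_eq,
    withDensity_apply _ (measurableSet_extChartAt_image hA hAp)]

lemma chartVolume_restrict_source (p : M) :
    (chartVolume I p).restrict (chartAt H p).source = chartVolume I p := by
  have hT := measurableSet_extChartAt_target (I := I) p
  refine Measure.restrict_eq_self_of_ae_mem ?_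
  refine (ae_map_iff ((continuousOn_extChartAt_symm p).aemeasurable hT)
    (chartAt H p).open_source.measurableSet).2 ?_
  filter_upwards [ae_restrict_mem hT] with y hy
  exact extChartAt_symm_mem_source hy

lemma chartVolume_eq_of_subset_inter {p q : M} {A : Set M} (hA : MeasurableSet A)
    (hAp : A ⊆ (chartAt H p).source) (hAq : A ⊆ (chartAt H q).source) :
    chartVolume I p A = chartVolume I q A := by
  rw [chartVolume_apply hA hAp, chartVolume_apply hA hAq, ← image_extChartAt_comp_symm q hAp]
  have hS := measurableSet_extChartAt_image (I := I) hA hAp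
  have transition_hasFDerivWithinAt : ∀ y ∈ extChartAt I p '' A,
      HasFDerivWithinAt (extChartAt I q ∘ (extChartAt I p).symm)
        (toCoord I q ((extChartAt I p).symm y) ∘L ofCoord I p ((extChartAt I p).symm y))
        (extChartAt I p '' A) y := by
    rintro _ ⟨z, hz, rfl⟩
    rw [extChartAt_symm_apply (hAp hz)]
    exact (hasFDerivWithinAt_extChartAt_comp_symm (hAp hz) (hAq hz)).mono
      (image_subset_iff.2 fun x _ ↦ extChartAt_mem_range)
  rw [lintegral_image_eq_lintegral_abs_det_fderiv_mul volume hS transition_hasFDerivWithinAt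
    (injOn_extChartAt_comp_symm hAp hAq)]
  refine setLIntegral_congr_fun hS ?_
  rintro _ ⟨z, hz, rfl⟩
  dsimp only [Function.comp_apply]
  rw [extChartAt_symm_apply (hAp hz), extChartAt_symm_apply (hAq hz),
    gramDet_eq_det_sq_mul (hAp hz) (hAq hz), ← ENNReal.ofReal_mul (abs_nonneg _),
    Real.sqrt_mul (sq_nonneg _), Real.sqrt_sq_eq_abs]

variable [SecondCountableTopology M]

lemma riemannianVolume_restrict (p : M) :
    (riemannianVolume I M).restrict (chartAt H p).source = chartVolume I p := by
  obtain ⟨t, ht, hcover⟩ := TopologicalSpace.countable_cover_nhds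
    fun x : M ↦ (chartAt H x).open_source.mem_nhds (mem_chart_source H x)
  have ht_nonempty : t.Nonempty := by
    have : p ∈ ⋃ x ∈ t, (chartAt H x).source := hcover ▸ mem_univ p
    exact nonempty_of_mem (mem_iUnion₂.1 this).choose_spec.choose
  obtain ⟨e, rfl⟩ := ht.exists_eq_range ht_nonempty
  refine restrict_iSup_eq_of_restrict_inter_eq
    (fun x : M ↦ (chartAt H x).open_source.measurableSet) chartVolume_restrict_source
    (fun x y ↦ ?_) ((biUnion_range (f := e)).symm.trans hcover) p
  have hU := (chartAt H x).open_source.measurableSet.inter (chartAt H y).open_source.measurableSet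
  ext A hA
  rw [Measure.restrict_apply hA, Measure.restrict_apply hA]
  exact chartVolume_eq_of_subset_inter (hA.inter hU) (fun z hz ↦ hz.2.1) fun z hz ↦ hz.2.2

lemma riemannianVolume_apply {p : M} {A : Set M} (hA : MeasurableSet A)
    (hAp : A ⊆ (chartAt H p).source) :
    riemannianVolume I M A = ∫⁻ y in extChartAt I p '' A,
      ENNReal.ofReal (√(gramDet I p ((extChartAt I p).symm y))) := by
  rw [← chartVolume_apply hA hAp, ← riemannianVolume_restrict, Measure.restrict_eq_self _ hAp]

variable
  [IsContMDiffRiemannianBundle I ∞ (EuclideanSpace ℝ (Fin d)) (fun x : M ↦ TangentSpace I x)]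

lemma integral_riemannianVolume_eq_setIntegral {p : M} {F : M → ℝ} (hF : Continuous F)
    (hFp : ∀ q ∉ (chartAt H p).source, F q = 0) :
    ∫ q, F q ∂(riemannianVolume I M) =
      ∫ y in (extChartAt I p).target,
        √(gramDet I p ((extChartAt I p).symm y)) * F ((extChartAt I p).symm y) := by
  have hT := measurableSet_extChartAt_target (I := I) p
  rw [← setIntegral_eq_integral_of_forall_compl_eq_zero hFp, riemannianVolume_restrict,
    chartVolume_eq_map, integral_map ((continuousOn_extChartAt_symm p).aemeasurable hT)
      hF.measurable.aestronglyMeasurable,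
    setIntegral_withDensity_eq_setIntegral_toReal_smul₀
    ((continuousOn_sqrt_gramDet p).aemeasurable hT).ennreal_ofReal
    (ae_of_all _ fun _ ↦ ENNReal.ofReal_lt_top) _ hT]
  simp only [ENNReal.toReal_ofReal (Real.sqrt_nonneg _), smul_eq_mul]

lemma isLocallyFiniteMeasure_riemannianVolume :
    IsLocallyFiniteMeasure (riemannianVolume I M) := by
  refine ⟨fun p ↦ ?_⟩
  let C := √(gramDet I p p) + 1
  let B := Metric.ball (extChartAt I p p) 1
  have density_lt : ∀ᶠ q in 𝓝 p, √(gramDet I p q) < C :=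
    (contMDiffAt_gramDet (mem_chart_source H p)).continuousAt.sqrt.eventually_lt_const
      (lt_add_one _)
  have mem_ball : ∀ᶠ q in 𝓝 p, extChartAt I p q ∈ B :=
    (continuousAt_extChartAt p).eventually_mem (Metric.ball_mem_nhds _ one_pos)
  obtain ⟨A, hA_sub, hA, hpA⟩ := mem_nhds_iff.1
    ((density_lt.and mem_ball).and (chart_source_mem_nhds H p))
  have hAp : A ⊆ (chartAt H p).source := fun q hq ↦ (hA_sub hq).2
  refine ⟨A, hA.mem_nhds hpA, ?_⟩
  calc riemannianVolume I M A
      = ∫⁻ y in extChartAt I p '' A, ENNReal.ofReal (√(gramDet I p ((extChartAt I p).symm y))) :=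
        riemannianVolume_apply hA.measurableSet hAp
    _ ≤ ∫⁻ _ in extChartAt I p '' A, ENNReal.ofReal C := by
        refine setLIntegral_mono' (measurableSet_extChartAt_image hA.measurableSet hAp) ?_
        rintro _ ⟨q, hq, rfl⟩
        rw [extChartAt_symm_apply (hAp hq)]
        exact ENNReal.ofReal_le_ofReal (hA_sub hq).1.1.le
    _ ≤ ∫⁻ _ in B, ENNReal.ofReal C :=
        lintegral_mono_set (image_subset_iff.2 fun q hq ↦ (hA_sub hq).1.2)
    _ < ⊤ := by
        rw [setLIntegral_const]
        exact ENNReal.mul_lt_top ENNReal.ofReal_lt_top measure_ball_lt_top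

lemma isOpenPosMeasure_riemannianVolume : (riemannianVolume I M).IsOpenPosMeasure := by
  refine ⟨fun U hU ⟨p, hpU⟩ hUzero ↦ ?_⟩
  let A := U ∩ (chartAt H p).source
  have hA : IsOpen A := hU.inter (chartAt H p).open_source
  have hAp : A ⊆ (chartAt H p).source := inter_subset_right
  have hS := measurableSet_extChartAt_image (I := I) hA.measurableSet hAp
  have hSzero : ∫⁻ y in extChartAt I p '' A,
      ENNReal.ofReal (√(gramDet I p ((extChartAt I p).symm y))) = 0 := by
    rw [← riemannianVolume_apply hA.measurableSet hAp]
    exact measure_mono_null inter_subset_left hUzero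
  refine volume_extChartAt_image_ne_zero (I := I)
    (hA.mem_nhds ⟨hpU, mem_chart_source H p⟩) ?_
  have density_zero := (setLIntegral_eq_zero_iff' hS (((continuousOn_sqrt_gramDet p).mono
    (extChartAt_image_subset_target hAp)).aemeasurable hS).ennreal_ofReal).1 hSzero
  refine measure_eq_zero_iff_ae_notMem.2 (density_zero.mono ?_)
  rintro _ hy ⟨q, hq, rfl⟩
  have := hy ⟨q, hq, rfl⟩
  rw [extChartAt_symm_apply (hAp hq), ENNReal.ofReal_eq_zero] at this
  exact this.not_gt (Real.sqrt_pos.2 (gramDet_pos (hAp hq)))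

end ChartVolume

/-! ### The divergence theorem -/

section LocalDivergence

variable {d : ℕ}
  {H : Type*} [TopologicalSpace H] {I : ModelWithCorners ℝ (EuclideanSpace ℝ (Fin d)) H}
  {M : Type*} [TopologicalSpace M] [ChartedSpace H M] [IsManifold I ∞ M]

lemma continuousAt_mvfderiv_coordVector {h : M → ℝ} {p q : M} (hq : q ∈ (chartAt H p).source)
    (hh : ContMDiffAt I 𝓘(ℝ, ℝ) ∞ h q) (i : Fin d) :
    ContinuousAt (fun z ↦ mvfderiv I h z (coordVector I p z i)) q := by
  have derivative_continuous : ContinuousWithinAt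
      (fderivWithin ℝ (h ∘ (extChartAt I p).symm) (range I)) (range I) (extChartAt I p q) :=
    ((contDiffWithinAt_comp_extChartAt_symm hq hh).fderivWithin_right (m := 0) I.uniqueDiffOn
      (by simp) extChartAt_mem_range).continuousWithinAt
  have chart_tendsto : Tendsto (extChartAt I p) (𝓝 q) (𝓝[range I] (extChartAt I p q)) :=
    tendsto_nhdsWithin_iff.2 ⟨continuousAt_extChartAt' (by rwa [extChartAt_source]),
      Eventually.of_forall fun _ ↦ extChartAt_mem_range⟩
  refine ContinuousAt.congr
    (((ContinuousLinearMap.apply ℝ ℝ (EuclideanSpace.single i (1 : ℝ))).continuous.tendsto _).comp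
      (derivative_continuous.tendsto.comp chart_tendsto)) ?_
  filter_upwards [(chartAt H p).open_source.mem_nhds hq,
    (contMDiffAt_iff_contMDiffAt_nhds (n := 1) (by simp)).1 (hh.of_le (by simp))] with z hz hhz
  rw [coordVector_eq hz, mvfderiv_ofCoord hz (hhz.mdifferentiableAt one_ne_zero)]
  rfl

variable [RiemannianBundle (fun x : M ↦ TangentSpace I x)]
  [IsContMDiffRiemannianBundle I ∞ (EuclideanSpace ℝ (Fin d)) (fun x : M ↦ TangentSpace I x)]

variable (I) in
/-- The component `√(det g) Zⁱ` of the flux density of a vector field `Z` in the chart around `p`.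
Unlike `coordFlux` it is taken with respect to the unsigned volume density. -/
def densityFlux (p : M) (Z : ∀ q : M, TangentSpace I q) (i : Fin d) (q : M) : ℝ :=
  √(gramDet I p q) * toCoord I p q (Z q) i

lemma contMDiffAt_densityFlux {p q : M} (hq : q ∈ (chartAt H p).source)
    {Z : ∀ q : M, TangentSpace I q} (hZ : ContMDiffAt I I.tangent ∞ (T% Z) q) (i : Fin d) :
    ContMDiffAt I 𝓘(ℝ, ℝ) ∞ (densityFlux I p Z i) q :=
  ((Real.contDiffAt_sqrt (gramDet_pos hq).ne').contMDiffAt.comp q (contMDiffAt_gramDet hq)).mul <|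
    (EuclideanSpace.proj i : EuclideanSpace ℝ (Fin d) →L[ℝ] ℝ).contDiff.contMDiff.contMDiffAt.comp q
      ((contMDiffAt_along_iff (b := fun q ↦ q) hq).1 hZ).2

variable (o : ManifoldOrientation I M) {Z W : ∀ q : M, TangentSpace I q}

include o

lemma continuous_divergence (hZ : ContMDiff I I.tangent ∞ (T% Z)) :
    Continuous (divergence I Z) := by
  refine continuous_iff_continuousAt.2 fun q ↦ ?_
  have hq := mem_chart_source H q
  have divergence_eq : divergence I Z =ᶠ[𝓝 q] fun z ↦ (coordVol o q z)⁻¹ *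
      ∑ i, mvfderiv I (coordFlux o q Z i) z (coordVector I q z i) := by
    filter_upwards [chart_source_mem_nhds H q] with z hz
    rw [← coordVol_mul_divergence o hZ hz, inv_mul_cancel_left₀ (coordVol_ne_zero o hz)]
  refine ContinuousAt.congr ?_ divergence_eq.symm
  exact ((contMDiffAt_coordVol o hq).continuousAt.inv₀ (coordVol_ne_zero o hq)).mul
    (tendsto_finsetSum _ fun i _ ↦
      continuousAt_mvfderiv_coordVector hq (contMDiffAt_coordFlux o hZ.contMDiffAt hq i) i)

lemma divergence_eq_zero_of_notMem_closure (hZ : ContMDiff I I.tangent ∞ (T% Z)) {q : M}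
    (hq : q ∉ closure {p | Z p ≠ 0}) : divergence I Z q = 0 := by
  refine mul_left_cancel₀ (coordVol_ne_zero o (mem_chart_source H q)) ?_
  rw [coordVol_mul_divergence o hZ (mem_chart_source H q), mul_zero]
  refine Finset.sum_eq_zero fun i _ ↦ ?_
  have flux_eq_zero : coordFlux o q Z i =ᶠ[𝓝 q] fun _ ↦ 0 := by
    filter_upwards [isClosed_closure.isOpen_compl.mem_nhds hq] with z hz
    have : Z z = 0 := not_not.1 fun h ↦ hz (subset_closure h)
    rw [coordFlux, this, map_zero, PiLp.zero_apply, mul_zero]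
  rw [mvfderiv_congr_of_eventuallyEq flux_eq_zero, mvfderiv_const]
  rfl

lemma divergence_add (hZ : ContMDiff I I.tangent ∞ (T% Z)) (hW : ContMDiff I I.tangent ∞ (T% W)) :
    divergence I (Z + W) = divergence I Z + divergence I W := by
  funext q
  have hq := mem_chart_source H q
  refine mul_left_cancel₀ (coordVol_ne_zero o hq) ?_
  rw [Pi.add_apply, mul_add, coordVol_mul_divergence o (hZ.add_section hW) hq,
    coordVol_mul_divergence o hZ hq, coordVol_mul_divergence o hW hq, ← Finset.sum_add_distrib]
  refine Finset.sum_congr rfl fun i _ ↦ ?_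
  have flux_add : coordFlux o q (Z + W) i = coordFlux o q Z i + coordFlux o q W i := by
    funext z
    simp only [coordFlux, Pi.add_apply, map_add, PiLp.add_apply, mul_add]
  rw [flux_add, mvfderiv_add
    ((contMDiffAt_coordFlux o hZ.contMDiffAt hq i).mdifferentiableAt (by simp))
    ((contMDiffAt_coordFlux o hW.contMDiffAt hq i).mdifferentiableAt (by simp)), add_apply]

lemma divergence_zero : divergence I (0 : ∀ q : M, TangentSpace I q) = 0 := by
  funext q
  refine divergence_eq_zero_of_notMem_closure o (contMDiff_zeroSection ℝ _) ?_
  simp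

lemma divergence_finsetSum {ι : Type*} (T : Finset ι) {Z : ι → ∀ q : M, TangentSpace I q}
    (hZ : ∀ k ∈ T, ContMDiff I I.tangent ∞ (T% (Z k))) :
    divergence I (∑ k ∈ T, Z k) = ∑ k ∈ T, divergence I (Z k) := by
  classical
  induction T using Finset.induction_on with
  | empty => exact divergence_zero o
  | insert k T hk ih =>
    obtain ⟨hk_smooth, hT_smooth⟩ := Finset.forall_mem_insert .. |>.1 hZ
    rw [Finset.sum_insert hk, Finset.sum_insert hk, divergence_add o hk_smooth, ih hT_smooth]
    convert ContMDiff.sum_section hT_smooth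
    rw [Finset.sum_apply]

lemma eventually_sqrt_gramDet_eq {p q : M} (hq : q ∈ (chartAt H p).source) :
    ∃ ε : ℝ, ∀ᶠ z in 𝓝 q, √(gramDet I p z) = ε * coordVol o p z := by
  have coordVol_continuousAt := (contMDiffAt_coordVol o hq).continuousAt
  rcases lt_or_gt_of_ne (coordVol_ne_zero o hq) with h | h
  · refine ⟨-1, ?_⟩
    filter_upwards [coordVol_continuousAt.eventually_lt_const h] with z hz
    rw [← coordVol_sq o, Real.sqrt_sq_eq_abs, abs_of_neg hz, neg_one_mul]
  · refine ⟨1, ?_⟩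
    filter_upwards [coordVol_continuousAt.eventually_const_lt h] with z hz
    rw [← coordVol_sq o, Real.sqrt_sq_eq_abs, abs_of_pos hz, one_mul]

lemma sqrt_gramDet_mul_divergence (hZ : ContMDiff I I.tangent ∞ (T% Z)) {p q : M}
    (hq : q ∈ (chartAt H p).source) :
    √(gramDet I p q) * divergence I Z q =
      ∑ i, mvfderiv I (densityFlux I p Z i) q (coordVector I p q i) := by
  obtain ⟨ε, hε⟩ := eventually_sqrt_gramDet_eq o hq
  rw [hε.self_of_nhds, mul_assoc, coordVol_mul_divergence o hZ hq, Finset.mul_sum]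
  refine Finset.sum_congr rfl fun i _ ↦ ?_
  have flux_eq : densityFlux I p Z i =ᶠ[𝓝 q] (fun _ ↦ ε) * coordFlux o p Z i := by
    filter_upwards [hε] with z hz
    rw [densityFlux, hz, mul_assoc]
    rfl
  rw [mvfderiv_congr_of_eventuallyEq flux_eq, mvfderiv_mul mdifferentiableAt_const
    ((contMDiffAt_coordFlux o hZ.contMDiffAt hq i).mdifferentiableAt (by simp)), mvfderiv_const]
  simp

end LocalDivergence

section Integration

variable {E : Type*} [NormedAddCommGroup E] [NormedSpace ℝ E] [FiniteDimensional ℝ E]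
  [MeasurableSpace E] [BorelSpace E] (μ : Measure E) [μ.IsAddHaarMeasure]

lemma integral_fderiv_eq_zero {h : E → ℝ} (hh : ContDiff ℝ 1 h) (hs : HasCompactSupport h)
    (v : E) : ∫ x, fderiv ℝ h x v ∂μ = 0 := by
  have derivative_integrable : Integrable (fun x ↦ fderiv ℝ h x v) μ :=
    ((hh.continuous_fderiv (by simp)).clm_apply continuous_const).integrable_of_hasCompactSupport
      ((hs.fderiv ℝ).comp_left (g := fun L : E →L[ℝ] ℝ ↦ L v) rfl)
  simpa using integral_mul_fderiv_eq_neg_fderiv_mul_of_integrable (μ := μ) (𝕜 := ℝ)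
    (f := fun _ : E ↦ (1 : ℝ)) (g := h) (v := v) (by simp) (by simpa using derivative_integrable)
    (by simpa using hh.continuous.integrable_of_hasCompactSupport hs) (by fun_prop)
    (fun x _ ↦ hh.differentiable (by simp) x)

lemma setIntegral_fderiv_eq_zero {K U : Set E} (hK : IsCompact K) (hU : IsOpen U) (hKU : K ⊆ U)
    {h : E → ℝ} (hh : ∀ x ∈ K, ContDiffAt ℝ 1 h x) (hzero : ∀ x ∈ U \ K, h x = 0) (v : E) :
    ∫ x in K, fderiv ℝ h x v ∂μ = 0 := by
  let g := U.indicator h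
  have eq_near {x : E} (hx : x ∈ K) : g =ᶠ[𝓝 x] h := by
    filter_upwards [hU.mem_nhds (hKU hx)] with y hy
    exact indicator_of_mem hy h
  have eq_zero {x : E} (hx : x ∉ K) : g x = 0 :=
    indicator_apply_eq_zero.2 fun hxU ↦ hzero x ⟨hxU, hx⟩
  have eq_zero_near {x : E} (hx : x ∉ K) : g =ᶠ[𝓝 x] fun _ ↦ 0 := by
    filter_upwards [hK.isClosed.isOpen_compl.mem_nhds hx] with y hy
    exact eq_zero hy
  have g_smooth : ContDiff ℝ 1 g := contDiff_iff_contDiffAt.2 fun x ↦ by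
    by_cases hx : x ∈ K
    · exact (hh x hx).congr_of_eventuallyEq (eq_near hx)
    · exact contDiffAt_const.congr_of_eventuallyEq (eq_zero_near hx)
  calc ∫ x in K, fderiv ℝ h x v ∂μ
      = ∫ x in K, fderiv ℝ g x v ∂μ := setIntegral_congr_fun hK.measurableSet fun x hx ↦ by
        rw [(eq_near hx).fderiv_eq]
    _ = ∫ x, fderiv ℝ g x v ∂μ := setIntegral_eq_integral_of_forall_compl_eq_zero fun x hx ↦ by
        rw [(eq_zero_near hx).fderiv_eq, fderiv_fun_const]
        rfl
    _ = 0 := integral_fderiv_eq_zero μ g_smooth (HasCompactSupport.intro hK fun x ↦ eq_zero) v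

lemma setIntegral_sum_fderiv_eq_zero {ι : Type*} [Fintype ι] {K U : Set E} (hK : IsCompact K)
    (hU : IsOpen U) (hKU : K ⊆ U) {h : ι → E → ℝ} (hh : ∀ i, ∀ x ∈ K, ContDiffAt ℝ 1 (h i) x)
    (hzero : ∀ i, ∀ x ∈ U \ K, h i x = 0) (v : ι → E) :
    ∫ x in K, ∑ i, fderiv ℝ (h i) x (v i) ∂μ = 0 := by
  have derivative_integrable (i : ι) : IntegrableOn (fun x ↦ fderiv ℝ (h i) x (v i)) K μ :=
    ContinuousOn.integrableOn_compact hK fun x hx ↦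
      (((hh i x hx).fderiv_right (m := 0) (by simp)).continuousAt.clm_apply
        continuousAt_const).continuousWithinAt
  rw [integral_finsetSum _ fun i _ ↦ derivative_integrable i]
  exact Finset.sum_eq_zero fun i _ ↦
    setIntegral_fderiv_eq_zero μ hK hU hKU (hh i) (hzero i) (v i)

end Integration

section DivergenceTheorem

variable {d : ℕ}
  {H : Type*} [TopologicalSpace H] {I : ModelWithCorners ℝ (EuclideanSpace ℝ (Fin d)) H}
  {M : Type*} [TopologicalSpace M] [ChartedSpace H M]

lemma range_mem_nhds_of_mem_interior_target {p : M} {x : EuclideanSpace ℝ (Fin d)}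
    (hx : x ∈ interior (extChartAt I p).target) : range I ∈ 𝓝 x :=
  mem_of_superset (mem_interior_iff_mem_nhds.1 hx) (extChartAt_target_subset_range p)

variable [IsManifold I ∞ M]

lemma extChartAt_mem_interior_target {p q : M} (hq : q ∈ (chartAt H p).source)
    (hint : q ∈ I.interior M) : extChartAt I p q ∈ interior (extChartAt I p).target :=
  (I.isInteriorPoint_iff_of_mem_atlas (n := ∞) (by simp) (chart_mem_atlas H p) hq).1 hint

variable [RiemannianBundle (fun x : M ↦ TangentSpace I x)]
  [IsContMDiffRiemannianBundle I ∞ (EuclideanSpace ℝ (Fin d)) (fun x : M ↦ TangentSpace I x)]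
  {Z : ∀ q : M, TangentSpace I q}

lemma contDiffAt_densityFlux_comp_extChartAt_symm (hZ : ContMDiff I I.tangent ∞ (T% Z)) {p : M}
    {x : EuclideanSpace ℝ (Fin d)} (hx : x ∈ interior (extChartAt I p).target) (i : Fin d) :
    ContDiffAt ℝ ∞ (densityFlux I p Z i ∘ (extChartAt I p).symm) x := by
  have hxt := interior_subset hx
  have hq := extChartAt_symm_mem_source hxt
  have smooth_within := contDiffWithinAt_comp_extChartAt_symm hq
    (contMDiffAt_densityFlux hq hZ.contMDiffAt i)
  rw [(extChartAt I p).right_inv hxt] at smooth_within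
  exact smooth_within.contDiffAt (range_mem_nhds_of_mem_interior_target hx)

variable (o : ManifoldOrientation I M)

include o

lemma sqrt_gramDet_mul_divergence_extChartAt_symm (hZ : ContMDiff I I.tangent ∞ (T% Z)) {p : M}
    {x : EuclideanSpace ℝ (Fin d)} (hx : x ∈ interior (extChartAt I p).target) :
    √(gramDet I p ((extChartAt I p).symm x)) * divergence I Z ((extChartAt I p).symm x) =
      ∑ i, fderiv ℝ (densityFlux I p Z i ∘ (extChartAt I p).symm) x
        (EuclideanSpace.single i 1) := by
  have hxt := interior_subset hx
  have hq := extChartAt_symm_mem_source hxt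
  rw [sqrt_gramDet_mul_divergence o hZ hq]
  refine Finset.sum_congr rfl fun i _ ↦ ?_
  rw [coordVector_eq hq, mvfderiv_ofCoord hq
    ((contMDiffAt_densityFlux hq hZ.contMDiffAt i).mdifferentiableAt (by simp)),
    (extChartAt I p).right_inv hxt,
    fderivWithin_of_mem_nhds (range_mem_nhds_of_mem_interior_target hx)]

variable [SecondCountableTopology M] [MeasurableSpace M] [BorelSpace M]

lemma integral_divergence_eq_zero_of_subset_chart (hZ : ContMDiff I I.tangent ∞ (T% Z))
    (hc : IsCompact (closure {q | Z q ≠ 0})) (hint : closure {q | Z q ≠ 0} ⊆ I.interior M)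
    {p : M} (hp : closure {q | Z q ≠ 0} ⊆ (chartAt H p).source) :
    ∫ q, divergence I Z q ∂(riemannianVolume I M) = 0 := by
  let e := extChartAt I p
  let K := e '' closure {q | Z q ≠ 0}
  let flux (i : Fin d) := densityFlux I p Z i ∘ e.symm
  have K_compact : IsCompact K :=
    hc.image_of_continuousOn ((continuousOn_extChartAt p).mono (by rwa [extChartAt_source]))
  have K_subset : K ⊆ interior e.target :=
    image_subset_iff.2 fun q hq ↦ extChartAt_mem_interior_target (hp hq) (hint hq)
  have notMem_closure {x} (hx : x ∈ e.target \ K) : e.symm x ∉ closure {q | Z q ≠ 0} :=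
    fun hxZ ↦ hx.2 ⟨_, hxZ, e.right_inv hx.1⟩
  have flux_eq_zero (i : Fin d) : ∀ x ∈ interior e.target \ K, flux i x = 0 := fun x hx ↦ by
    have : Z (e.symm x) = 0 := not_not.1 fun hZx ↦
      notMem_closure ⟨interior_subset hx.1, hx.2⟩ (subset_closure hZx)
    simp only [flux, Function.comp_apply, densityFlux, this, map_zero, PiLp.zero_apply, mul_zero]
  have flux_smooth (i : Fin d) : ∀ x ∈ K, ContDiffAt ℝ 1 (flux i) x := fun x hx ↦
    (contDiffAt_densityFlux_comp_extChartAt_symm hZ (K_subset hx) i).of_le (by simp)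
  calc ∫ q, divergence I Z q ∂(riemannianVolume I M)
      = ∫ x in e.target, √(gramDet I p (e.symm x)) * divergence I Z (e.symm x) :=
        integral_riemannianVolume_eq_setIntegral (continuous_divergence o hZ) fun q hq ↦
          divergence_eq_zero_of_notMem_closure o hZ fun hqZ ↦ hq (hp hqZ)
    _ = ∫ x in K, √(gramDet I p (e.symm x)) * divergence I Z (e.symm x) :=
        setIntegral_eq_of_subset_of_forall_sdiff_eq_zero (measurableSet_extChartAt_target p)
          (K_subset.trans interior_subset) fun x hx ↦ by
            rw [divergence_eq_zero_of_notMem_closure o hZ (notMem_closure hx), mul_zero]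
    _ = ∫ x in K, ∑ i, fderiv ℝ (flux i) x (EuclideanSpace.single i 1) :=
        setIntegral_congr_fun K_compact.measurableSet fun x hx ↦
          sqrt_gramDet_mul_divergence_extChartAt_symm o hZ (K_subset hx)
    _ = 0 := setIntegral_sum_fderiv_eq_zero volume K_compact isOpen_interior K_subset
        flux_smooth flux_eq_zero _

variable [T2Space M]

lemma integral_divergence_eq_zero (hZ : ContMDiff I I.tangent ∞ (T% Z))
    (hc : IsCompact (closure {q | Z q ≠ 0})) (hint : closure {q | Z q ≠ 0} ⊆ I.interior M) :
    ∫ q, divergence I Z q ∂(riemannianVolume I M) = 0 := by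
  have : LocallyCompactSpace H := I.locallyCompactSpace
  have : LocallyCompactSpace M := ChartedSpace.locallyCompactSpace H M
  have := isLocallyFiniteMeasure_riemannianVolume (I := I) (M := M)
  obtain ⟨ρ, hρ⟩ := SmoothPartitionOfUnity.exists_isSubordinate_chartAt_source I M
  let T := (ρ.locallyFinite.finite_nonempty_inter_compact hc).toFinset
  let piece (k : M) : ∀ q : M, TangentSpace I q := fun q ↦ ρ k q • Z q
  have piece_smooth (k : M) : ContMDiff I I.tangent ∞ (T% (piece k)) :=
    (ρ k).contMDiff.smul_section hZ
  have sum_piece : Z = ∑ k ∈ T, piece k := by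
    funext q
    rw [Finset.sum_apply, ← Finset.sum_smul]
    by_cases hq : Z q = 0
    · rw [hq, smul_zero]
    have : ∑ k ∈ T, ρ k q = 1 := by
      rw [← ρ.sum_eq_one (mem_univ q), finsum_eq_sum_of_support_subset]
      exact fun k hk ↦ (Set.Finite.mem_toFinset _).2 ⟨q, hk, subset_closure hq⟩
    rw [this, one_smul]
  have closure_piece_subset (k : M) : closure {q | piece k q ≠ 0} ⊆ closure {q | Z q ≠ 0} :=
    closure_mono fun q hq hZq ↦ hq (by simp only [piece, hZq, smul_zero])
  have closure_piece_subset_source (k : M) :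
      closure {q | piece k q ≠ 0} ⊆ (chartAt H k).source :=
    have : {q | piece k q ≠ 0} ⊆ Function.support (ρ k) :=
      fun q hq hρq ↦ hq (by simp only [piece, hρq, zero_smul])
    (closure_mono this).trans (hρ k)
  have piece_compact (k : M) : IsCompact (closure {q | piece k q ≠ 0}) :=
    hc.of_isClosed_subset isClosed_closure (closure_piece_subset k)
  have piece_integrable (k : M) : Integrable (divergence I (piece k)) (riemannianVolume I M) :=
    (continuous_divergence o (piece_smooth k)).integrable_of_hasCompactSupport <|
      HasCompactSupport.intro (piece_compact k) fun q hq ↦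
        divergence_eq_zero_of_notMem_closure o (piece_smooth k) hq
  rw [sum_piece, divergence_finsetSum o T fun k _ ↦ piece_smooth k]
  simp only [Finset.sum_apply]
  rw [integral_finsetSum _ fun k _ ↦ piece_integrable k]
  exact Finset.sum_eq_zero fun k _ ↦ integral_divergence_eq_zero_of_subset_chart o
    (piece_smooth k) (piece_compact k) ((closure_piece_subset k).trans hint)
    (closure_piece_subset_source k)

end DivergenceTheorem

section WeakCoderivative

variable {d : ℕ}
  {H₁ : Type*} [TopologicalSpace H₁] {I₁ : ModelWithCorners ℝ (EuclideanSpace ℝ (Fin d)) H₁}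
  {M₁ : Type*} [TopologicalSpace M₁] [ChartedSpace H₁ M₁]
  {H₂ : Type*} [TopologicalSpace H₂] {I₂ : ModelWithCorners ℝ (EuclideanSpace ℝ (Fin d)) H₂}
  {M₂ : Type*} [TopologicalSpace M₂] [ChartedSpace H₂ M₂] [IsManifold I₂ ∞ M₂]
  {f : M₁ → M₂}

lemma isSmoothAlong_zero (hf : ContMDiff I₁ I₂ ∞ f) : IsSmoothAlong I₁ I₂ f (fun _ ↦ 0) :=
  (contMDiff_zeroSection ℝ (fun y : M₂ ↦ TangentSpace I₂ y)).comp hf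

lemma IsSmoothAlong.smul {σ : ∀ p : M₁, TangentSpace I₂ (f p)} (hσ : IsSmoothAlong I₁ I₂ f σ)
    {ρ : M₁ → ℝ} (hρ : ContMDiff I₁ 𝓘(ℝ, ℝ) ∞ ρ) :
    IsSmoothAlong I₁ I₂ f (fun p ↦ ρ p • σ p) := fun q ↦ by
  have hy := mem_chart_source H₂ (f q)
  obtain ⟨base_smooth, coord_smooth⟩ := (contMDiffAt_along_iff hy).1 (hσ q)
  refine (contMDiffAt_along_iff hy).2 ⟨base_smooth, ?_⟩
  simp only [map_smul]
  exact (hρ q).smul coord_smooth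

variable [IsManifold I₁ ∞ M₁]

variable (I₁ M₁) in
lemma dense_interior : Dense (I₁.interior M₁) := fun p ↦ by
  have symm_image_subset :
      (extChartAt I₁ p).symm '' interior (extChartAt I₁ p).target ⊆ I₁.interior M₁ := by
    rintro _ ⟨x, hx, rfl⟩
    refine (I₁.isInteriorPoint_iff_of_mem_atlas (n := ∞) (by simp) (chart_mem_atlas H₁ p)
      (extChartAt_symm_mem_source (interior_subset hx))).2 ?_
    rwa [show (chartAt H₁ p).extend I₁ ((extChartAt I₁ p).symm x) = x from
      (extChartAt I₁ p).right_inv (interior_subset hx)]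
  rw [← extChartAt_to_inv (I := I₁) p]
  exact closure_mono symm_image_subset <| mem_closure_image
    (continuousAt_extChartAt_symm p) <|
      extChartAt_target_subset_closure_interior (mem_extChartAt_target p)

variable [RiemannianBundle (fun x : M₁ ↦ TangentSpace I₁ x)]
  [RiemannianBundle (fun x : M₂ ↦ TangentSpace I₂ x)]
  [IsContMDiffRiemannianBundle I₁ ∞ (EuclideanSpace ℝ (Fin d)) (fun x : M₁ ↦ TangentSpace I₁ x)]
  [IsContMDiffRiemannianBundle I₂ ∞ (EuclideanSpace ℝ (Fin d)) (fun x : M₂ ↦ TangentSpace I₂ x)]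
  [T2Space M₁] [SecondCountableTopology M₁] [MeasurableSpace M₁] [BorelSpace M₁]

lemma eq_zero_of_forall_integral_inner_eq_zero {η : ∀ p : M₁, TangentSpace I₂ (f p)}
    (hη : IsSmoothAlong I₁ I₂ f η)
    (h : ∀ σ : ∀ p : M₁, TangentSpace I₂ (f p), IsSmoothAlong I₁ I₂ f σ →
      IsCompact (closure {p | σ p ≠ 0}) → closure {p | σ p ≠ 0} ⊆ I₁.interior M₁ →
      ∫ p, inner ℝ (σ p) (η p) ∂(riemannianVolume I₁ M₁) = 0) : η = 0 := by
  have := isLocallyFiniteMeasure_riemannianVolume (I := I₁) (M := M₁)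
  have := isOpenPosMeasure_riemannianVolume (I := I₁) (M := M₁)
  have inner_continuous : Continuous fun p ↦ (inner ℝ (η p) (η p) : ℝ) :=
    (ContMDiff.inner_bundle (IB := I₂) (F := EuclideanSpace ℝ (Fin d))
      (E := fun x : M₂ ↦ TangentSpace I₂ x) (b := f) hη hη).continuous
  have inner_eq_zero_of_interior : ∀ q ∈ I₁.interior M₁, (inner ℝ (η q) (η q) : ℝ) = 0 := by
    intro q hq
    by_contra inner_ne_zero
    obtain ⟨φ, -, tsupport_subset⟩ := (SmoothBumpFunction.nhds_basis_tsupport (I := I₁) q).mem_iff.1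
      ((I₁.isOpen_interior (n := ∞) (by simp)).mem_nhds hq)
    have closure_subset : closure {p | φ p • η p ≠ 0} ⊆ tsupport φ :=
      closure_mono fun p hp hφ ↦ hp (by rw [hφ, zero_smul])
    have integral_eq_zero := h (fun p ↦ φ p • η p) (hη.smul φ.contMDiff)
      (φ.hasCompactSupport.of_isClosed_subset isClosed_closure closure_subset)
      (closure_subset.trans tsupport_subset)
    simp only [real_inner_smul_left] at integral_eq_zero
    refine ((φ.continuous.mul inner_continuous).integral_pos_of_hasCompactSupport_nonneg_nonzero
      φ.hasCompactSupport.mul_right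
      (fun p ↦ mul_nonneg φ.nonneg real_inner_self_nonneg) (x := q) ?_).ne' integral_eq_zero
    rwa [Pi.mul_apply, φ.eq_one, one_mul]
  have inner_eq_zero : (fun p ↦ (inner ℝ (η p) (η p) : ℝ)) = fun _ ↦ 0 :=
    inner_continuous.ext_on (dense_interior I₁ M₁) continuous_const inner_eq_zero_of_interior
  exact funext fun p ↦ inner_self_eq_zero.1 (congrFun inner_eq_zero p)

variable (o₁ : ManifoldOrientation I₁ M₁) (o₂ : ManifoldOrientation I₂ M₂)

lemma integral_connectionInnerCof_eq_zero (hf : ContMDiff I₁ I₂ ∞ f)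
    {σ : ∀ p : M₁, TangentSpace I₂ (f p)} (hσ : IsSmoothAlong I₁ I₂ f σ)
    (hc : IsCompact (closure {p | σ p ≠ 0})) (hint : closure {p | σ p ≠ 0} ⊆ I₁.interior M₁) :
    ∫ q, connectionInnerCof o₁ o₂ f σ q ∂(riemannianVolume I₁ M₁) = 0 := by
  have closure_subset : closure {p | piolaAlong o₁ o₂ f σ p ≠ 0} ⊆ closure {p | σ p ≠ 0} :=
    closure_mono fun p hp hσp ↦ hp (by rw [piolaAlong, hσp, map_zero])
  simp only [← divergence_piolaAlong o₁ o₂ hf hσ]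
  exact integral_divergence_eq_zero o₁ (contMDiff_piolaAlong o₁ o₂ hf hσ)
    (hc.of_isClosed_subset isClosed_closure closure_subset) (closure_subset.trans hint)

lemma isCoderivative_cofDifferential_zero (hf : ContMDiff I₁ I₂ ∞ f) :
    IsCoderivative I₁ I₂ f (cofDifferential o₁ o₂ f) 0 where
  smooth := isSmoothAlong_zero hf
  adjoint σ hσ hc hint := by
    simp only [Pi.zero_apply, inner_zero_right, integral_zero]
    exact (integral_connectionInnerCof_eq_zero o₁ o₂ hf hσ hc hint).symm

lemma IsCoderivative.eq_zero_of_cofDifferential (hf : ContMDiff I₁ I₂ ∞ f)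
    {δ : ∀ p : M₁, TangentSpace I₂ (f p)}
    (hδ : IsCoderivative I₁ I₂ f (cofDifferential o₁ o₂ f) δ) : δ = 0 :=
  eq_zero_of_forall_integral_inner_eq_zero hδ.smooth fun σ hσ hc hint ↦
    (hδ.adjoint σ hσ hc hint).trans (integral_connectionInnerCof_eq_zero o₁ o₂ hf hσ hc hint)

end WeakCoderivative

end Piola

end

theorem mainTheorem2_general {d : ℕ}
    {H₁ : Type*} [TopologicalSpace H₁] (I₁ : ModelWithCorners ℝ (EuclideanSpace ℝ (Fin d)) H₁)
    {M₁ : Type*} [TopologicalSpace M₁] [T2Space M₁] [SecondCountableTopology M₁]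
    [ChartedSpace H₁ M₁] [IsManifold I₁ ∞ M₁]
    [RiemannianBundle (fun x : M₁ ↦ TangentSpace I₁ x)]
    [IsContMDiffRiemannianBundle I₁ ∞ (EuclideanSpace ℝ (Fin d)) (fun x : M₁ ↦ TangentSpace I₁ x)]
    [MeasurableSpace M₁] [BorelSpace M₁]
    {H₂ : Type*} [TopologicalSpace H₂] (I₂ : ModelWithCorners ℝ (EuclideanSpace ℝ (Fin d)) H₂)
    {M₂ : Type*} [TopologicalSpace M₂] [ChartedSpace H₂ M₂] [IsManifold I₂ ∞ M₂]
    [RiemannianBundle (fun x : M₂ ↦ TangentSpace I₂ x)]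
    [IsContMDiffRiemannianBundle I₂ ∞ (EuclideanSpace ℝ (Fin d)) (fun x : M₂ ↦ TangentSpace I₂ x)]
    (o₁ : Piola.ManifoldOrientation I₁ M₁) (o₂ : Piola.ManifoldOrientation I₂ M₂)
    (f : M₁ → M₂) (hf : ContMDiff I₁ I₂ ∞ f) :
    (∀ δ : ∀ p : M₁, TangentSpace I₂ (f p),
      Piola.IsCoderivative I₁ I₂ f (Piola.cofDifferential o₁ o₂ f) δ ↔ δ = 0) ∧
    ∀ X : ∀ y : M₂, TangentSpace I₂ y, ContMDiff I₂ I₂.tangent ∞ (T% X) →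
      ContMDiff I₁ I₁.tangent ∞ (T% (Piola.piola o₁ o₂ f X)) ∧
      ∀ p : M₁, Piola.divergence I₁ (Piola.piola o₁ o₂ f X) p =
        Piola.divergence I₂ X (f p) * Piola.detDifferential o₁ o₂ f p := by
  refine ⟨fun δ ↦ ⟨fun hδ ↦ hδ.eq_zero_of_cofDifferential o₁ o₂ hf, ?_⟩, fun X hX ↦
    ⟨Piola.contMDiff_piolaAlong o₁ o₂ hf (hX.comp hf), Piola.divergence_piola o₁ o₂ hf hX⟩⟩
  rintro rfl
  exact Piola.isCoderivative_cofDifferential_zero o₁ o₂ hf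

theorem mainTheorem2 {d : ℕ} [NeZero d]
    {H₁ : Type*} [TopologicalSpace H₁] (I₁ : ModelWithCorners ℝ (EuclideanSpace ℝ (Fin d)) H₁)
    {M₁ : Type*} [TopologicalSpace M₁] [T2Space M₁] [SecondCountableTopology M₁]
    [ChartedSpace H₁ M₁] [IsManifold I₁ ∞ M₁]
    [RiemannianBundle (fun x : M₁ ↦ TangentSpace I₁ x)]
    [IsContMDiffRiemannianBundle I₁ ∞ (EuclideanSpace ℝ (Fin d)) (fun x : M₁ ↦ TangentSpace I₁ x)]
    [MeasurableSpace M₁] [BorelSpace M₁]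
    {H₂ : Type*} [TopologicalSpace H₂] (I₂ : ModelWithCorners ℝ (EuclideanSpace ℝ (Fin d)) H₂)
    {M₂ : Type*} [TopologicalSpace M₂] [T2Space M₂] [SecondCountableTopology M₂]
    [ChartedSpace H₂ M₂] [IsManifold I₂ ∞ M₂]
    [RiemannianBundle (fun x : M₂ ↦ TangentSpace I₂ x)]
    [IsContMDiffRiemannianBundle I₂ ∞ (EuclideanSpace ℝ (Fin d)) (fun x : M₂ ↦ TangentSpace I₂ x)]
    (o₁ : Piola.ManifoldOrientation I₁ M₁) (o₂ : Piola.ManifoldOrientation I₂ M₂)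
    (f : M₁ → M₂) (hf : ContMDiff I₁ I₂ ∞ f) :
    ∃ δ : ∀ p : M₁, TangentSpace I₂ (f p),
      Piola.IsCoderivative I₁ I₂ f (Piola.cofDifferential o₁ o₂ f) δ ∧
      (∀ δ' : ∀ p : M₁, TangentSpace I₂ (f p),
        Piola.IsCoderivative I₁ I₂ f (Piola.cofDifferential o₁ o₂ f) δ' → δ' = δ) ∧
      ∀ X : ∀ y : M₂, TangentSpace I₂ y,
        ContMDiff I₂ I₂.tangent ∞ (fun y ↦ (⟨y, X y⟩ : TangentBundle I₂ M₂)) →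
        ContMDiff I₁ I₁.tangent ∞
          (fun p ↦ (⟨p, Piola.piola o₁ o₂ f X p⟩ : TangentBundle I₁ M₁)) ∧
        ∀ p : M₁,
          Piola.divergence I₁ (Piola.piola o₁ o₂ f X) p =
            Piola.divergence I₂ X (f p) * Piola.detDifferential o₁ o₂ f p
              - inner ℝ (X (f p)) (δ p) := by
  obtain ⟨isCoderivative_iff, piola_spec⟩ := mainTheorem2_general I₁ I₂ o₁ o₂ f hf
  exact ⟨0, (isCoderivative_iff 0).2 rfl, fun δ' ↦ (isCoderivative_iff δ').1, fun X hX ↦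
    ⟨(piola_spec X hX).1, fun p ↦ by
      rw [(piola_spec X hX).2, Pi.zero_apply, inner_zero_right, sub_zero]⟩⟩
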